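/- Let $p$ be a prime and $0\neq\lambda\in\mathbb F_p$. \textbf{Mixable shuffles.} For an abelian (i.e. commutative) semigroup $S$, written multiplicatively and not necessarily having a unit, let $M^{\otimes}(S)$ be the free monoid of words $u_1\otimes\cdots\otimes u_r$ ($r\ge 0$, $u_i\in S$). The mixable shuffle algebra $Ш_{\mathbb F_p,\lambda}(S)$ is the $\mathbb F_p$-vector space with basis $M^{\otimes}(S)$ and the bilinear product $\diamond$ for which the empty word is the unit and $$(a\otimes u)\diamond(b\otimes v)=a\otimes\big(u\diamond(b\otimes v)\big)+b\otimes\big((a\otimes u)\diamond v\big)+\lambda\,(ab)\otimes(u\diamond v)\qquad(a,b\in S,\ u,v\in M^{\otimes}(S)).$$ \textbf{Words.} Let $S$ moreover be totally ordered. A Lyndon word is a non-empty word that is lexicographically smaller than each of its proper non-empty suffixes; let $L$ be the set of Lyndon words. For a word $w=u_1\otimes\cdots\otimes u_r$ put $\ell(w)=r$ and $w^{(p)}=u_1^p\otimes\cdots\otimes u_r^p$. For a set $W$ of words put $W_1=\{w\in W: w^{(p)}=w\}$, $W_2=\{w\in W: w^{(p)}\ne w\}$, $E(W)=\{w\in W: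 w=w^{(p)}\text{ or } w\neq u^{(p)}\text{ for every word }u\}$ and $T(W)=\{w^{\otimes p^i}: w\in W,\ i\ge 0\}$. Set $TEL=T(E(L))$, $TEL_i=T(E(L_i))$ and $TL_i=T(L_i)$ for $i=1,2$, and $D_2=\{w-w^{(p)}: w\in TL_2\}\subset Ш_{\mathbb F_p,\lambda}(S)$. For a subset $Y\subset Ш_{\mathbb F_p,\lambda}(S)$, $\mathbb F_p[\underline Y]$ denotes the polynomial algebra on symbols $\underline y$ in bijection with $y\in Y$. \textbf{Classes.} $\mathcal P$ is the class of well-ordered abelian semigroups $S$ such that for all $a,b\in S$: $a>b\Rightarrow a^p>b^p$, and $a^p\ge a$. $\mathcal J$ is the class of well-ordered abelian semigroups such that $g^{p^2}=g^p$ for every $g$, and $g_1<g_2$ whenever $g_1^p=g_1$ and $g_2^p\neq g_2$. (The order is not assumed compatible with the multiplication.) $\mathcal F$ is the class of free abelian semigroups on finite totally ordered sets $X$, ordered by total degree and, in equal degree, lexicographically by the exponents, the exponent of the smallest generator being compared first. \textbf{Theorem.} All isomorphisms below are isomorphisms of $\mathbb F_p$-algebras, induced by the evaluation $\underline y\mapsto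 y$. (1) For $S\in\mathcal P$, $$Ш_{\mathbb F_p,\lambda}(S)\cong \mathbb F_p[\underline{TEL}]\big/\big\langle \underline w^p-\lambda^{(p-1)(\ell(w)-1)}\underline w : w\in TEL_1\big\rangle\cong \Big(\mathbb F_p[\underline{TEL_1}]\big/\big\langle \underline w^p-\lambda^{(p-1)(\ell(w)-1)}\underline w: w\in TEL_1\big\rangle\Big)\otimes\mathbb F_p[\underline{TEL_2}].$$ In particular, for $S\in\mathcal F$, $Ш_{\mathbb F_p,\lambda}(S)\cong\mathbb F_p[\underline{TEL}]$. (2) For $S\in\mathcal J$, $$Ш_{\mathbb F_p,\lambda}(S)\cong\Big(\mathbb F_p[\underline{TL_1}]\big/\big\langle \underline w^p-\lambda^{(p-1)(\ell(w)-1)}\underline w: w\in TL_1\big\rangle\Big)\otimes\Big(\mathbb F_p[\underline{D_2}]\big/\big\langle \underline y^p: y\in D_2\big\rangle\Big).$$ (Since $\lambda^{p-1}=1$ in $\mathbb F_p$, the coefficients $\lambda^{(p-1)(\ell(w)-1)}$ all equal $1$.) -/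

import Mathlib

open scoped TensorProduct

/-! ## Powers in a semigroup -/

/-- The power `g ^ n` in a semigroup, for `n ≥ 1` (the value at `n = 0` is never used). -/
def semigroupPow {S : Type*} [Mul S] (g : S) : ℕ → S
  | 0 => g
  | 1 => g
  | n + 2 => semigroupPow g (n + 1) * g

/-- In the semigroup with a unit adjoined, `semigroupPow` is the usual power. -/
theorem coe_semigroupPow {S : Type*} [Semigroup S] (g : S) (n : ℕ) :
    ((semigroupPow g (n + 1) : S) : WithOne S) = (g : WithOne S) ^ (n + 1) := by
  induction n with
  | zero => simp [semigroupPow]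
  | succ n ih => rw [semigroupPow, WithOne.coe_mul, ih, pow_succ _ (n + 1)]

/-! ## The mixable shuffle algebra of a commutative semigroup

Words in the alphabet `S` are lists `[s₁, …, sᵣ]`, standing for the pure tensors
`s₁ ⊗ ⋯ ⊗ sᵣ`; tensor concatenation is `++` and the empty list is `1`. -/

/-- The underlying `k`-module of the mixable shuffle algebra of weight `lam` on `S`: the direct sum
of the tensor powers of the semigroup algebra `k S`, that is, the free `k`-module on words. -/
def MixableShuffle {k : Type*} [CommRing k] (_lam : k) (S : Type*) : Type _ := List S →₀ k

namespace MixableShuffle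

variable {k : Type*} [CommRing k] {lam : k} {S : Type*}

noncomputable instance : AddCommGroup (MixableShuffle lam S) :=
  inferInstanceAs (AddCommGroup (List S →₀ k))

noncomputable instance : Module k (MixableShuffle lam S) :=
  inferInstanceAs (Module k (List S →₀ k))

/-- A word, as a basis element of the mixable shuffle algebra. -/
noncomputable def word (lam : k) (w : List S) : MixableShuffle lam S :=
  Finsupp.single w (1 : k)

/-- The linear map that sends a word `w` to `a ⊗ w`. -/
noncomputable def consLin (lam : k) (a : S) : MixableShuffle lam S →ₗ[k] MixableShuffle lam S :=
  Finsupp.linearCombination k fun w : List S => word lam (a :: w)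

/-- The mixable shuffle product of two words:
`(a ⊗ u) ⋄ (b ⊗ v) = a ⊗ (u ⋄ (b ⊗ v)) + b ⊗ ((a ⊗ u) ⋄ v) + lam • (a b) ⊗ (u ⋄ v)`,
with the empty word as unit. -/
noncomputable def mulWord [Mul S] (lam : k) : List S → List S → MixableShuffle lam S
  | [], v => word lam v
  | a :: u, [] => word lam (a :: u)
  | a :: u, b :: v =>
      consLin lam a (mulWord lam u (b :: v)) + consLin lam b (mulWord lam (a :: u) v)
        + lam • consLin lam (a * b) (mulWord lam u v)
termination_by u v => u.length + v.length

/-- The bilinear extension of the product of words. -/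
noncomputable def mulLin [Mul S] (lam : k) :
    MixableShuffle lam S →ₗ[k] MixableShuffle lam S →ₗ[k] MixableShuffle lam S :=
  Finsupp.linearCombination k fun u : List S =>
    (Finsupp.linearCombination k fun v : List S => mulWord lam u v :
      MixableShuffle lam S →ₗ[k] MixableShuffle lam S)

noncomputable instance [Mul S] : Mul (MixableShuffle lam S) := ⟨fun x y => mulLin lam x y⟩

noncomputable instance : One (MixableShuffle lam S) := ⟨word lam []⟩

theorem mul_def [Mul S] (x y : MixableShuffle lam S) : x * y = mulLin lam x y := rfl

theorem one_def : (1 : MixableShuffle lam S) = word lam [] := rfl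

@[simp] theorem consLin_word (a : S) (w : List S) :
    consLin lam a (word lam w) = word lam (a :: w) :=
  (Finsupp.linearCombination_single k (1 : k) w).trans (one_smul k _)

@[simp] theorem mulLin_word [Mul S] (u v : List S) :
    mulLin lam (word lam u) (word lam v) = mulWord lam u v := by
  have h1 : mulLin lam (word lam u) =
      (Finsupp.linearCombination k fun v : List S => mulWord lam u v :
        MixableShuffle lam S →ₗ[k] MixableShuffle lam S) :=
    (Finsupp.linearCombination_single k (1 : k) u).trans (one_smul k _)
  rw [h1]
  exact (Finsupp.linearCombination_single k (1 : k) v).trans (one_smul k _)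

/-- The product of two words is given by the recursion `mulWord`. -/
theorem word_mul_word [Mul S] (u v : List S) :
    word lam u * word lam v = mulWord lam u v := mulLin_word u v

/-- Linear maps that agree on words are equal. -/
theorem linearMap_ext {N : Type*} [AddCommGroup N] [Module k N]
    {f g : MixableShuffle lam S →ₗ[k] N} (h : ∀ w, f (word lam w) = g (word lam w)) : f = g :=
  Finsupp.lhom_ext' fun w => LinearMap.ext_ring (h w)

theorem mulLin_cons_cons [Mul S] (a b : S) (x y : MixableShuffle lam S) :
    mulLin lam (consLin lam a x) (consLin lam b y) =
      consLin lam a (mulLin lam x (consLin lam b y))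
        + consLin lam b (mulLin lam (consLin lam a x) y)
        + lam • consLin lam (a * b) (mulLin lam x y) := by
  have h : (mulLin lam).compl₁₂ (consLin lam a) (consLin lam b) =
      ((mulLin lam).compl₂ (consLin lam b)).compr₂ (consLin lam a)
        + ((mulLin lam) ∘ₗ (consLin lam a)).compr₂ (consLin lam b)
        + lam • (mulLin lam).compr₂ (consLin lam (a * b)) := by
    refine linearMap_ext fun u => linearMap_ext fun v => ?_
    simp [mulWord]
  simpa using LinearMap.congr_fun (LinearMap.congr_fun h x) y

theorem one_mulLin [Mul S] (x : MixableShuffle lam S) : mulLin lam (word lam []) x = x := by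
  have h : mulLin lam (word lam []) = (LinearMap.id : MixableShuffle lam S →ₗ[k] _) :=
    linearMap_ext fun v => by simp [mulWord]
  rw [h, LinearMap.id_apply]

theorem mulLin_one [Mul S] (x : MixableShuffle lam S) : mulLin lam x (word lam []) = x := by
  have h : (mulLin lam).flip (word lam []) = (LinearMap.id : MixableShuffle lam S →ₗ[k] _) :=
    linearMap_ext fun v => by cases v <;> simp [mulWord]
  simpa using LinearMap.congr_fun h x

theorem mulWord_comm [CommSemigroup S] (n : ℕ) (u v : List S) (h : u.length + v.length ≤ n) :
    mulWord lam u v = mulWord lam v u := by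
  induction n generalizing u v with
  | zero =>
    obtain ⟨rfl, rfl⟩ : u = [] ∧ v = [] := by
      constructor <;> apply List.eq_nil_of_length_eq_zero <;> omega
    rfl
  | succ n ih =>
    cases u with
    | nil => cases v <;> simp [mulWord]
    | cons a u =>
      cases v with
      | nil => simp [mulWord]
      | cons b v =>
        simp only [List.length_cons] at h
        rw [mulWord, mulWord, ih u (b :: v) (by simp only [List.length_cons]; omega),
          ih (a :: u) v (by simp only [List.length_cons]; omega), ih u v (by omega), mul_comm a b]
        abel

theorem mulLin_comm [CommSemigroup S] (x y : MixableShuffle lam S) :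
    mulLin lam x y = mulLin lam y x := by
  have h : mulLin lam = (mulLin lam : MixableShuffle lam S →ₗ[k] _).flip :=
    linearMap_ext fun u => linearMap_ext fun v => by
      simpa using mulWord_comm _ u v le_rfl
  exact LinearMap.congr_fun (LinearMap.congr_fun h x) y

theorem mulLin_assoc_word [CommSemigroup S] (n : ℕ) (u v w : List S)
    (h : u.length + v.length + w.length ≤ n) :
    mulLin lam (mulLin lam (word lam u) (word lam v)) (word lam w) =
      mulLin lam (word lam u) (mulLin lam (word lam v) (word lam w)) := by
  induction n generalizing u v w with
  | zero =>
    obtain ⟨rfl, rfl, rfl⟩ : u = [] ∧ v = [] ∧ w = [] := by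
      refine ⟨?_, ?_, ?_⟩ <;> apply List.eq_nil_of_length_eq_zero <;> omega
    simp only [one_mulLin]
  | succ n ih =>
    rcases u with _ | ⟨a, u⟩
    · simp only [one_mulLin]
    rcases v with _ | ⟨b, v⟩
    · simp only [one_mulLin, mulLin_one]
    rcases w with _ | ⟨c, w⟩
    · simp only [mulLin_one]
    simp only [List.length_cons] at h
    have e1 := ih u (b :: v) (c :: w) (by simp only [List.length_cons]; omega)
    have e2 := ih (a :: u) v (c :: w) (by simp only [List.length_cons]; omega)
    have e3 := ih (a :: u) (b :: v) w (by simp only [List.length_cons]; omega)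
    have e4 := ih u v (c :: w) (by simp only [List.length_cons]; omega)
    have e5 := ih u (b :: v) w (by simp only [List.length_cons]; omega)
    have e6 := ih (a :: u) v w (by simp only [List.length_cons]; omega)
    have e7 := ih u v w (by omega)
    simp only [← consLin_word] at e1 e2 e3 e4 e5 e6 e7 ⊢
    generalize word lam u = x at *
    generalize word lam v = y at *
    generalize word lam w = z at *
    rw [mulLin_cons_cons b c y z] at e1 ⊢
    rw [mulLin_cons_cons a b x y] at e3 ⊢
    have f1 := congrArg (consLin lam a) e1
    have f2 := congrArg (consLin lam b) e2
    have f3 := congrArg (consLin lam c) e3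
    have f4 := congrArg (consLin lam (a * b)) e4
    have f5 := congrArg (consLin lam (a * c)) e5
    have f6 := congrArg (consLin lam (b * c)) e6
    have f7 := congrArg (consLin lam (a * b * c)) e7
    simp only [map_add, map_smul, LinearMap.add_apply, LinearMap.smul_apply, mulLin_cons_cons,
      ← mul_assoc] at f1 f2 f3 f4 f5 f6 f7 ⊢
    linear_combination (norm := module) f1 + f2 + f3 + lam • f4 + lam • f5 + lam • f6 + (lam * lam) • f7

theorem mulLin_assoc [CommSemigroup S] (x y z : MixableShuffle lam S) :
    mulLin lam (mulLin lam x y) z = mulLin lam x (mulLin lam y z) := by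
  have h1 (u v : List S) : mulLin lam (mulLin lam (word lam u) (word lam v)) =
      mulLin lam (word lam u) ∘ₗ mulLin lam (word lam v) :=
    linearMap_ext fun w => mulLin_assoc_word _ u v w le_rfl
  have h2 (u : List S) : mulLin lam ∘ₗ mulLin lam (word lam u) =
      (mulLin lam).compr₂ (mulLin lam (word lam u)) :=
    linearMap_ext fun v => h1 u v
  have h3 : (mulLin lam).flip z ∘ₗ (mulLin lam).flip y =
      (mulLin lam).flip (mulLin lam y z) :=
    linearMap_ext fun u => LinearMap.congr_fun (LinearMap.congr_fun (h2 u) y) z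
  exact LinearMap.congr_fun h3 x

noncomputable instance [CommSemigroup S] : CommRing (MixableShuffle lam S) where
  __ := (inferInstance : AddCommGroup (MixableShuffle lam S))
  mul := (· * ·)
  one := 1
  left_distrib x y z := (mulLin lam x).map_add y z
  right_distrib x y z := LinearMap.congr_fun ((mulLin lam).map_add x y) z
  zero_mul x := LinearMap.congr_fun (mulLin lam).map_zero x
  mul_zero x := (mulLin lam x).map_zero
  mul_assoc := mulLin_assoc
  mul_comm := mulLin_comm
  one_mul := one_mulLin
  mul_one := mulLin_one

noncomputable instance [CommSemigroup S] : Algebra k (MixableShuffle lam S) :=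
  Algebra.ofModule (fun r x y => LinearMap.congr_fun ((mulLin lam).map_smul r x) y)
    (fun r x y => (mulLin lam x).map_smul r y)

end MixableShuffle

/-! ## Lyndon words and operators on sets of words -/

/-- Lexicographic order on words: `u < v` if `v = u ⊗ x` with `x` non-empty, or if `u`, `v` have a
common prefix after which `u` continues with a smaller letter than `v`. -/
def lexLT {S : Type*} [LT S] (u v : List S) : Prop := List.Lex (· < ·) u v

/-- The set of Lyndon words: non-empty words that are smaller than all their proper non-empty
suffixes. -/
def lyndonWords (S : Type*) [LT S] : Set (List S) :=
  {w | w ≠ [] ∧ ∀ u v : List S, w = u ++ v → u ≠ [] → v ≠ [] → lexLT w v}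

/-- The word `w^(p) = u₁ ^ p ⊗ ⋯ ⊗ uᵣ ^ p` for `w = u₁ ⊗ ⋯ ⊗ uᵣ`. -/
def wordFrob {S : Type*} [Mul S] (p : ℕ) (w : List S) : List S :=
  w.map fun s => semigroupPow s p

/-- The tensor power `w ⊗ ⋯ ⊗ w` (`n` factors). -/
def wordPow {S : Type*} (w : List S) (n : ℕ) : List S := (List.replicate n w).flatten

/-- `W₁ = {w ∈ W | w^(p) = w}`. -/
def fixedPart {S : Type*} [Mul S] (p : ℕ) (W : Set (List S)) : Set (List S) :=
  {w | w ∈ W ∧ wordFrob p w = w}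

/-- `W₂ = {w ∈ W | w^(p) ≠ w}`. -/
def movedPart {S : Type*} [Mul S] (p : ℕ) (W : Set (List S)) : Set (List S) :=
  {w | w ∈ W ∧ wordFrob p w ≠ w}

/-- `E(W)`: the `w ∈ W` with `w = w^(p)` or with `w ≠ u^(p)` for every word `u`. -/
def essentialPart {S : Type*} [Mul S] (p : ℕ) (W : Set (List S)) : Set (List S) :=
  {w | w ∈ W ∧ (w = wordFrob p w ∨ ∀ u : List S, w ≠ wordFrob p u)}

/-- `T(W)`: the tensor powers `w^{⊗ p^i}` with `w ∈ W` and `i ≥ 0`. -/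
def tensorPowers {S : Type*} (p : ℕ) (W : Set (List S)) : Set (List S) :=
  {w | ∃ u ∈ W, ∃ i : ℕ, w = wordPow u (p ^ i)}

section Families

variable (p : ℕ) (S : Type*) [Mul S] [LT S]

/-- `TEL = T(E(L))`, where `L` is the set of Lyndon words. -/
def TEL : Set (List S) := tensorPowers p (essentialPart p (lyndonWords S))

/-- `TEL₁ = T(E(L₁))`. -/
def TEL1 : Set (List S) := tensorPowers p (essentialPart p (fixedPart p (lyndonWords S)))

/-- `TEL₂ = T(E(L₂))`. -/
def TEL2 : Set (List S) := tensorPowers p (essentialPart p (movedPart p (lyndonWords S)))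

/-- `TL₁ = T(L₁)`. -/
def TL1 : Set (List S) := tensorPowers p (fixedPart p (lyndonWords S))

/-- `TL₂ = T(L₂)`. -/
def TL2 : Set (List S) := tensorPowers p (movedPart p (lyndonWords S))

/-- The set of elements `w - w^(p)` of the mixable shuffle algebra, for `w ∈ TL₂`. -/
def differencesTL2 {k : Type*} [CommRing k] (lam : k) : Set (MixableShuffle lam S) :=
  {x | ∃ w ∈ TL2 p S, x = MixableShuffle.word lam w - MixableShuffle.word lam (wordFrob p w)}

end Families

/-! ## The classes of semigroups -/

/-- The class `𝒫`: well-ordered commutative semigroups such that `a > b` implies `a ^ p > b ^ p`,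
and `a ^ p ≥ a` for all `a`. The order need not be compatible with the multiplication. -/
structure IsClassP (p : ℕ) (S : Type*) [CommSemigroup S] [LinearOrder S] : Prop where
  wellFounded : WellFoundedLT S
  pow_lt_pow : ∀ a b : S, a > b → semigroupPow a p > semigroupPow b p
  le_pow : ∀ a : S, semigroupPow a p ≥ a

/-- The class `𝒥`: well-ordered commutative semigroups such that `g ^ (p ^ 2) = g ^ p` for all `g`,
and `g₁ < g₂` whenever `g₁ ^ p = g₁` and `g₂ ^ p ≠ g₂`. -/
structure IsClassJ (p : ℕ) (S : Type*) [CommSemigroup S] [LinearOrder S] : Prop where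
  wellFounded : WellFoundedLT S
  pow_sq : ∀ g : S, semigroupPow g (p ^ 2) = semigroupPow g p
  fixed_lt : ∀ g₁ g₂ : S, semigroupPow g₁ p = g₁ → semigroupPow g₂ p ≠ g₂ → g₁ < g₂

/-- The free commutative semigroup on `X`: the non-constant monomials `∏ x ^ n_x` in the variables
`x ∈ X`. They are ordered by total degree, and in equal degree lexicographically by the exponents
(the exponent of the smallest variable is compared first). -/
def FreeCommSemigroup (X : Type*) : Type _ :=
  {m : Multiplicative (DegLex (X →₀ ℕ)) // m ≠ 1}

namespace FreeCommSemigroup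

variable {X : Type*}

noncomputable instance : CommSemigroup (FreeCommSemigroup X) where
  mul a b := ⟨a.1 * b.1, fun h => a.2 (by
    have h' : ofDegLex a.1.toAdd + ofDegLex b.1.toAdd = 0 := h
    exact (add_eq_zero.mp h').1)⟩
  mul_assoc a b c := Subtype.ext (mul_assoc a.1 b.1 c.1)
  mul_comm a b := Subtype.ext (mul_comm a.1 b.1)

noncomputable instance [LinearOrder X] : LinearOrder (FreeCommSemigroup X) :=
  inferInstanceAs (LinearOrder {m : Multiplicative (DegLex (X →₀ ℕ)) // m ≠ 1})

end FreeCommSemigroup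

/-! ## Presentations by generators and relations -/

section Relations

variable {k : Type*} [CommRing k] {S : Type*}

/-- For a set `Y` of words and a subset `R` of it, the ideal of the polynomial algebra on symbols
`x_w` (`w ∈ Y`) generated by `x_w ^ p - lam ^ ((p - 1) (ℓ(w) - 1)) x_w` for `w ∈ R`. -/
noncomputable def frobIdeal (p : ℕ) (lam : k) (Y R : Set (List S)) : Ideal (MvPolynomial Y k) :=
  Ideal.span {f | ∃ w : Y, (w : List S) ∈ R ∧ f = MvPolynomial.X w ^ p -
    MvPolynomial.C (lam ^ ((p - 1) * ((w : List S).length - 1))) * MvPolynomial.X w}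

/-- The ideal of the polynomial algebra on symbols `x_y` (`y ∈ Y`) generated by all `x_y ^ p`. -/
noncomputable def powIdeal (k : Type*) [CommRing k] {A : Type*} (p : ℕ) (Y : Set A) :
    Ideal (MvPolynomial Y k) :=
  Ideal.span {f | ∃ y : Y, f = MvPolynomial.X y ^ p}

end Relations

/-!
The Frobenius map of the mixable shuffle algebra of weight `lam ≠ 0` over `ZMod p` sends a word `w`
to the word `w^(p)` (`word_pow_prime`): the `n`-th power of `a ⊗ x` is a sum, weighted by binomial
coefficients, of terms `a ^ i ⊗ ⋯` (`consLin_pow_succ`), and for `n = p` only `i = p` survives,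
with coefficient `lam ^ (p - 1) = 1`. This gives all the relations in the presentations.

That there are no further relations is a triangularity argument. Order words by length and then
lexicographically, and write `HasLead x w c` if `x` is `c • w` plus smaller words. The shorter words
in a product come from multiplying letters, so the leading word of a product of two words is their
largest shuffle. It is the concatenation, in non-increasing order, of all their Lyndon factors
(`maxShuffle`), and in `hasLead_mulWord` its multiplicity is computed together with it, by induction
along the recursion that defines the product. Multiplying by `l ^ ⊗ p ^ i` with `l` Lyndon
contributes the factor `(n + p ^ i).choose (p ^ i)`, where `n` is the multiplicity of `l`; modulo `p`
this is one more than the digit of `n` at `p ^ i`. Hence the monomials with exponents less than `p`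
in the words `l ^ ⊗ p ^ i`, or in any elements led by them, have non-zero leading coefficients, and
their leading words are distinct by the uniqueness of the Chen–Fox–Lyndon factorization and of base
`p` expansions (`linearIndependent_wordMonomial`). The same computation shows that these elements
generate the algebra (`adjoin_eq_top`), by well-founded induction on words.

For `S` in `𝒫` the map `w ↦ w^(p)` is injective, preserves and reflects Lyndon words, and does not
decrease words. So every word `l ^ ⊗ p ^ i` is `u^(p ^ j) = u ^ (p ^ j)` for some `u` in `TEL`, with
`u` and `j` unique unless `u` is fixed, and base `p` expansion of exponents turns monomials in `TEL`
into monomials with exponents less than `p` (`expandExponents`). For `S` in `𝒥` a word with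
`w^(p) ≠ w` exceeds `w^(p)`, hence leads `w - w^(p)`, and the `p`-th power of this difference is
`w^(p) - (w^(p))^(p) = 0`. In both cases the relations reduce the presented algebra to a spanning
family of monomials with linearly independent images (`injective_of_span_of_linearIndependent`).
-/

namespace MixableShuffle

/-! ### Shuffles and concatenations of words -/

section Words

variable {S : Type*}

/-- `IsShuffle u v s`: the word `s` is a shuffle of `u` and `v`. -/
inductive IsShuffle : List S → List S → List S → Prop
  | nil : IsShuffle [] [] []
  | left {a u v s} : IsShuffle u v s → IsShuffle (a :: u) v (a :: s)
  | right {b u v s} : IsShuffle u v s → IsShuffle u (b :: v) (b :: s)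

theorem IsShuffle.length {u v s : List S} (h : IsShuffle u v s) :
    s.length = u.length + v.length := by
  induction h with
  | nil => rfl
  | left _ ih => simp only [List.length_cons, ih]; omega
  | right _ ih => simp only [List.length_cons, ih]; omega

theorem isShuffle_nil_left (v : List S) : IsShuffle [] v v := by
  induction v with
  | nil => exact .nil
  | cons b v ih => exact .right ih

theorem isShuffle_nil_right (u : List S) : IsShuffle u [] u := by
  induction u with
  | nil => exact .nil
  | cons b v ih => exact .left ih

/-- A non-empty prefix of a concatenation ends inside one of the concatenated words. -/
theorem exists_suffix_prefix_of_prefix_flatten (F : List (List S)) (x y : List S) (hx : x ≠ [])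
    (h : F.flatten = x ++ y) : ∃ f ∈ F, ∃ t s z, x = t ++ s ∧ s ≠ [] ∧ f = s ++ z := by
  induction F generalizing x with
  | nil =>
    simp only [List.flatten_nil, List.nil_eq, List.append_eq_nil_iff] at h
    exact absurd h.1 hx
  | cons f F ih =>
    rw [List.flatten_cons] at h
    rcases List.append_eq_append_iff.1 h with ⟨x', h1, h2⟩ | ⟨x', h1, h2⟩
    · rcases eq_or_ne x' [] with rfl | hx'
      · exact ⟨f, by simp, [], x, [], by simp, hx, by simpa using h1.symm⟩
      · obtain ⟨g, hg, t, s, z, rfl, hs, h3⟩ := ih x' hx' h2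
        exact ⟨g, by simp [hg], f ++ t, s, z, by simpa using h1, hs, h3⟩
    · exact ⟨f, by simp, [], x, x', by simp, hx, h1⟩

end Words

section Combinatorics

variable {S : Type*} [LinearOrder S]

theorem cons_le_cons_left {u v : List S} (a : S) (h : u ≤ v) : a :: u ≤ a :: v := by
  rcases h.eq_or_lt with rfl | h
  · exact le_rfl
  · exact (List.cons_lt_cons_iff.2 (Or.inr ⟨rfl, h⟩)).le

/-! ### Lexicographic comparison of words -/

theorem append_lt_append_left_iff (u : List S) {x y : List S} : u ++ x < u ++ y ↔ x < y := by
  induction u with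
  | nil => simp
  | cons a u ih => simp [ih]

theorem lt_append_of_ne_nil (u : List S) {x : List S} (hx : x ≠ []) : u < u ++ x := by
  have h := (append_lt_append_left_iff u (x := []) (y := x)).2 (by
    cases x with
    | nil => exact absurd rfl hx
    | cons a x => exact List.nil_lt_cons a x)
  simpa using h

theorem le_append (u x : List S) : u ≤ u ++ x := by
  rcases eq_or_ne x [] with rfl | hx
  · simp
  · exact (lt_append_of_ne_nil u hx).le

/-- A strict lexicographic inequality is either a proper prefix relation, or it is decided at a
letter and then survives arbitrary continuations of both words. -/
theorem lt_cases {x y : List S} (h : x < y) :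
    (∃ z, z ≠ [] ∧ y = x ++ z) ∨ ∀ s t, x ++ s < y ++ t := by
  induction x generalizing y with
  | nil =>
    left
    exact ⟨y, by rintro rfl; exact lt_irrefl _ h, rfl⟩
  | cons a x ih =>
    cases y with
    | nil => exact absurd h (List.not_lt_nil _)
    | cons b y =>
      rcases List.cons_lt_cons_iff.1 h with hab | ⟨rfl, hxy⟩
      · right
        intro s t
        exact List.cons_lt_cons_iff.2 (Or.inl hab)
      · rcases ih hxy with ⟨z, hz, rfl⟩ | h'
        · exact Or.inl ⟨z, hz, rfl⟩
        · right
          intro s t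
          exact List.cons_lt_cons_iff.2 (Or.inr ⟨rfl, h' s t⟩)

theorem append_lt_append_of_length_le {x y : List S} (h : x < y) (hl : y.length ≤ x.length)
    (s t : List S) : x ++ s < y ++ t := by
  rcases lt_cases h with ⟨z, hz, rfl⟩ | h'
  · have := List.length_pos_of_ne_nil hz
    simp only [List.length_append] at hl
    omega
  · exact h' s t

/-! ### Lyndon words and the Chen–Fox–Lyndon factorization -/

theorem lt_of_suffix_of_mem_lyndonWords {w u v : List S} (hw : w ∈ lyndonWords S) (h : w = u ++ v)
    (hu : u ≠ []) (hv : v ≠ []) : w < v := hw.2 u v h hu hv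

theorem singleton_mem_lyndonWords (c : S) : [c] ∈ lyndonWords S := by
  refine ⟨by simp, fun u v h hu hv => ?_⟩
  have := congrArg List.length h
  have h1 := List.length_pos_of_ne_nil hu
  have h2 := List.length_pos_of_ne_nil hv
  simp only [List.length_append, List.length_singleton] at this
  omega

theorem append_mem_lyndonWords {d b : List S} (hd : d ∈ lyndonWords S) (hb : b ∈ lyndonWords S)
    (h : d < b) : d ++ b ∈ lyndonWords S := by
  have key : d ++ b < b := by
    rcases lt_cases h with ⟨z, hz, rfl⟩ | h'
    · exact (append_lt_append_left_iff d).2 (lt_of_suffix_of_mem_lyndonWords hb rfl hd.1 hz)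
    · simpa using h' b []
  refine ⟨by simp [hd.1], fun u v huv hu hv => ?_⟩
  change d ++ b < v
  rcases List.append_eq_append_iff.1 huv with ⟨x, rfl, hx⟩ | ⟨x, hx, rfl⟩
  · rcases eq_or_ne x [] with rfl | hx'
    · rw [List.nil_append] at hx
      rwa [← hx]
    · exact key.trans (lt_of_suffix_of_mem_lyndonWords hb hx hx' hv)
  · rcases eq_or_ne x [] with rfl | hx'
    · simpa using key
    · refine append_lt_append_of_length_le (lt_of_suffix_of_mem_lyndonWords hd hx hu hx') ?_ _ _
      rw [hx]
      simp

/-- Prepend the word `d` to a list of words, merging it with the words at the front as long as it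
is smaller than the next one. -/
def absorb : List S → List (List S) → List (List S)
  | d, [] => [d]
  | d, b :: F => if d < b then absorb (d ++ b) F else d :: b :: F

/-- The Chen–Fox–Lyndon factorization of a word: its factorization into a non-increasing sequence
of Lyndon words. -/
def cfl : List S → List (List S)
  | [] => []
  | c :: w => absorb [c] (cfl w)

/-- `absorb d F` merges `d` with an initial part `B` of `F`; each merged word still exceeds the
resulting Lyndon word, because the last one is a proper suffix of it. -/
theorem exists_absorb (F : List (List S)) (hF : F.Pairwise (· ≥ ·))
    (hL : ∀ f ∈ F, f ∈ lyndonWords S) (d : List S) (hd : d ∈ lyndonWords S) :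
    ∃ B G, F = B ++ G ∧ absorb d F = (d ++ B.flatten) :: G ∧ d ++ B.flatten ∈ lyndonWords S ∧
      (∀ g ∈ G, g ≤ d ++ B.flatten) ∧ ∀ b ∈ B, d ++ B.flatten < b := by
  induction F generalizing d with
  | nil => exact ⟨[], [], by simp [absorb, hd]⟩
  | cons b F ih =>
    rw [List.pairwise_cons] at hF
    by_cases hdb : d < b
    · have hdb' := append_mem_lyndonWords hd (hL b (by simp)) hdb
      obtain ⟨B, G, rfl, h1, h2, h3, h4⟩ := ih hF.2 (fun f hf => hL f (by simp [hf])) _ hdb'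
      rw [List.append_assoc] at h1 h2 h3 h4
      refine ⟨b :: B, G, rfl, by rw [absorb, if_pos hdb, h1, List.flatten_cons], h2, h3, ?_⟩
      intro f hf
      rw [List.flatten_cons]
      rcases List.mem_cons.1 hf with rfl | hf
      · cases B with
        | nil => simpa using lt_of_suffix_of_mem_lyndonWords hdb' rfl hd.1 (hL f (by simp)).1
        | cons b' B => exact (h4 b' (by simp)).trans_le (hF.1 b' (by simp))
      · exact h4 f hf
    · refine ⟨[], b :: F, rfl, by simp [absorb, hdb], by simpa using hd, ?_, by simp⟩
      intro g hg
      rw [List.flatten_nil, List.append_nil]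
      rcases List.mem_cons.1 hg with rfl | hg
      · exact not_lt.1 hdb
      · exact (hF.1 g hg).trans (not_lt.1 hdb)

theorem cfl_spec (w : List S) :
    (cfl w).Pairwise (· ≥ ·) ∧ (∀ f ∈ cfl w, f ∈ lyndonWords S) ∧ (cfl w).flatten = w := by
  induction w with
  | nil => simp [cfl]
  | cons c w ih =>
    obtain ⟨B, G, h0, h1, h2, h3, h4⟩ :=
      exists_absorb (cfl w) ih.1 ih.2.1 [c] (singleton_mem_lyndonWords c)
    have ih' := ih
    rw [h0] at ih'
    rw [cfl, h1]
    refine ⟨List.pairwise_cons.2 ⟨h3, (List.pairwise_append.1 ih'.1).2.1⟩, ?_, ?_⟩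
    · intro f hf
      rcases List.mem_cons.1 hf with rfl | hf
      · exact h2
      · exact ih'.2.1 f (by simp [hf])
    · rw [List.flatten_cons, List.append_assoc, ← List.flatten_append, ih'.2.2]
      rfl

/-- The first Lyndon factor of `c :: w` consists of `c` and of the factors of `w` that exceed it. -/
theorem exists_cfl_cons (c : S) (w : List S) :
    ∃ B G, cfl w = B ++ G ∧ cfl (c :: w) = (c :: B.flatten) :: G ∧
      (c :: B.flatten) ∈ lyndonWords S ∧
      (∀ g ∈ G, g ≤ c :: B.flatten) ∧ ∀ b ∈ B, c :: B.flatten < b :=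
  exists_absorb (cfl w) (cfl_spec w).1 (cfl_spec w).2.1 [c] (singleton_mem_lyndonWords c)

/-- Comparison of two Lyndon factorizations at their first factors: a Lyndon prefix of a
concatenation of words `≤ f` ends in a prefix of one of these words, and does not exceed this
suffix of its own. -/
theorem lyndon_prefix_le {F : List (List S)} {f x y : List S} (hF : ∀ g ∈ F, g ≤ f)
    (hx : x ∈ lyndonWords S) (h : F.flatten = x ++ y) : x ≤ f := by
  obtain ⟨g, hg, t, s, z, h1, hs, rfl⟩ := exists_suffix_prefix_of_prefix_flatten F x y hx.1 h
  have hxs : x ≤ s := by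
    rcases eq_or_ne t [] with rfl | ht
    · simpa using h1.le
    · exact (lt_of_suffix_of_mem_lyndonWords hx h1 ht hs).le
  exact (hxs.trans (le_append s z)).trans (hF _ hg)

theorem eq_of_flatten_eq (F G : List (List S)) (hF : F.Pairwise (· ≥ ·)) (hG : G.Pairwise (· ≥ ·))
    (hFL : ∀ f ∈ F, f ∈ lyndonWords S) (hGL : ∀ g ∈ G, g ∈ lyndonWords S)
    (h : F.flatten = G.flatten) : F = G := by
  induction F generalizing G with
  | nil =>
    cases G with
    | nil => rfl
    | cons g G =>
      simp only [List.flatten_nil, List.flatten_cons, List.nil_eq, List.append_eq_nil_iff] at h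
      exact absurd h.1 (hGL g (by simp)).1
  | cons f F ih =>
    cases G with
    | nil =>
      simp only [List.flatten_nil, List.flatten_cons, List.append_eq_nil_iff] at h
      exact absurd h.1 (hFL f (by simp)).1
    | cons g G =>
      rw [List.pairwise_cons] at hF hG
      obtain rfl : f = g := by
        apply le_antisymm
        · refine lyndon_prefix_le (F := g :: G) (y := F.flatten) ?_ (hFL f (by simp)) (by simp [← h])
          simpa using hG.1
        · refine lyndon_prefix_le (F := f :: F) (y := G.flatten) ?_ (hGL g (by simp)) (by simp [h])
          simpa using hF.1
      rw [List.flatten_cons, List.flatten_cons, List.append_cancel_left_eq] at h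
      rw [ih G hF.2 hG.2 (fun a ha => hFL a (by simp [ha])) (fun a ha => hGL a (by simp [ha])) h]

/-- Uniqueness of the Chen–Fox–Lyndon factorization. -/
theorem cfl_flatten {F : List (List S)} (hF : F.Pairwise (· ≥ ·))
    (hFL : ∀ f ∈ F, f ∈ lyndonWords S) : cfl F.flatten = F :=
  eq_of_flatten_eq _ _ (cfl_spec _).1 hF (cfl_spec _).2.1 hFL (cfl_spec _).2.2

/-! ### The largest shuffle of two words -/

/-- The concatenation of a multiset of words in non-increasing order. -/
def sortedConcat (m : Multiset (List S)) : List S := (m.sort (· ≥ ·)).flatten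

/-- The Lyndon factors of a word, with multiplicity. -/
def lyndonFactors (w : List S) : Multiset (List S) := (cfl w : Multiset (List S))

/-- The concatenation in non-increasing order of all the Lyndon factors of `u` and `v`. It is the
largest shuffle of `u` and `v`. -/
def maxShuffle (u v : List S) : List S := sortedConcat (lyndonFactors u + lyndonFactors v)

theorem sortedConcat_cons {a : List S} {m : Multiset (List S)} (h : ∀ b ∈ m, b ≤ a) :
    sortedConcat (a ::ₘ m) = a ++ sortedConcat m := by
  rw [sortedConcat, Multiset.sort_cons a m _ h, List.flatten_cons, sortedConcat]

theorem sortedConcat_append {B : List (List S)} (hB : B.Pairwise (· ≥ ·)) {m : Multiset (List S)}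
    (h : ∀ b ∈ B, ∀ a ∈ m, a ≤ b) :
    sortedConcat ((B : Multiset (List S)) + m) = B.flatten ++ sortedConcat m := by
  induction B with
  | nil => simp
  | cons b B ih =>
    rw [List.pairwise_cons] at hB
    rw [← Multiset.cons_coe, Multiset.cons_add, sortedConcat_cons, ih hB.2, List.flatten_cons,
      List.append_assoc]
    · exact fun b' hb' => h b' (by simp [hb'])
    · intro a ha
      rcases Multiset.mem_add.1 ha with ha | ha
      · exact hB.1 a (by simpa using ha)
      · exact h b (by simp) a ha

theorem sortedConcat_coe {F : List (List S)} (hF : F.Pairwise (· ≥ ·)) :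
    sortedConcat (F : Multiset (List S)) = F.flatten := by
  have h := sortedConcat_append hF (m := 0) (by simp)
  simpa [sortedConcat] using h

theorem lyndonFactors_subset (w : List S) : ∀ f ∈ lyndonFactors w, f ∈ lyndonWords S :=
  fun f hf => (cfl_spec w).2.1 f (by simpa [lyndonFactors] using hf)

theorem sortedConcat_lyndonFactors (w : List S) : sortedConcat (lyndonFactors w) = w := by
  rw [lyndonFactors, sortedConcat_coe (cfl_spec w).1, (cfl_spec w).2.2]

theorem lyndonFactors_sortedConcat {m : Multiset (List S)} (h : ∀ f ∈ m, f ∈ lyndonWords S) :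
    lyndonFactors (sortedConcat m) = m := by
  rw [lyndonFactors, sortedConcat, cfl_flatten (Multiset.pairwise_sort m _)
    (fun f hf => h f ((Multiset.mem_sort _).1 hf)), Multiset.sort_eq]

theorem maxShuffle_comm (u v : List S) : maxShuffle u v = maxShuffle v u := by
  rw [maxShuffle, add_comm, maxShuffle]

theorem maxShuffle_nil (u : List S) : maxShuffle u [] = u := by
  rw [maxShuffle]
  simpa [lyndonFactors, cfl] using sortedConcat_lyndonFactors u

theorem nil_maxShuffle (u : List S) : maxShuffle [] u = u := by
  rw [maxShuffle_comm, maxShuffle_nil]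

/-- If the first Lyndon factor of `c :: u` is at least every Lyndon factor of `v`, the largest
shuffle of `c :: u` and `v` starts with the letter `c` of `c :: u`. -/
theorem maxShuffle_cons_of_le {c : S} {u v l : List S} {G : List (List S)}
    (hl : cfl (c :: u) = l :: G) (hv : ∀ f ∈ cfl v, f ≤ l) :
    maxShuffle (c :: u) v = c :: maxShuffle u v := by
  obtain ⟨B, G', h1, h2, h3, h4, h5⟩ := exists_cfl_cons c u
  rw [h2] at hl
  obtain ⟨rfl, rfl⟩ := List.cons.inj hl
  have hs := (cfl_spec u).1
  rw [h1] at hs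
  have hm : ∀ a ∈ (G' : Multiset (List S)) + (cfl v : Multiset (List S)), a ≤ c :: B.flatten := by
    intro a ha
    rcases Multiset.mem_add.1 ha with ha | ha
    · exact h4 a (by simpa using ha)
    · exact hv a (by simpa using ha)
  rw [maxShuffle, maxShuffle, lyndonFactors, lyndonFactors, lyndonFactors, h2, h1,
    ← Multiset.cons_coe, Multiset.cons_add, sortedConcat_cons hm, ← Multiset.coe_add, add_assoc,
    sortedConcat_append (List.pairwise_append.1 hs).1, List.cons_append]
  exact fun b hb a ha => (hm a ha).trans (h5 b hb).le

theorem sortedConcat_lt_of_forall_le {a P r : List S} (ha : a ∈ lyndonWords S) (hP : P ≠ [])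
    (hr : r ≠ []) (haP : a = P ++ r) {m : Multiset (List S)} (hm : ∀ h ∈ m, h ≤ a) (t : List S) :
    sortedConcat (a ::ₘ m) < r ++ t := by
  rw [sortedConcat_cons hm]
  refine append_lt_append_of_length_le (lt_of_suffix_of_mem_lyndonWords ha haP hP hr) ?_ _ _
  rw [haP, List.length_append]
  omega

/-- The comparison behind `cons_maxShuffle_lt`. The words of `B` that exceed the Lyndon word
`a = P ++ r` come first in the sorted concatenation. Either one of them is smaller than the
corresponding part of `r` at some letter, or `a` follows while a proper suffix of `a`, which exceeds
`a`, is left of `r`. -/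
theorem sortedConcat_lt_of_flatten_lt {a P r : List S} {F G : List (List S)}
    (ha : a ∈ lyndonWords S) (hP : P ≠ []) (hr : r ≠ []) (haP : a = P ++ r)
    (hF : ∀ f ∈ F, f ≤ a) (hG : ∀ g ∈ G, g ≤ a) (B : List (List S))
    (hB : (B ++ G).Pairwise (· ≥ ·)) (hBr : B.flatten < r) (t : List S) :
    sortedConcat (a ::ₘ ((F : Multiset (List S)) + ((B ++ G : List (List S)) : Multiset (List S))))
      < r ++ t := by
  have hFH (H : List (List S)) (hH : ∀ h ∈ H, h ≤ a) :
      ∀ f ∈ (F : Multiset (List S)) + (H : Multiset (List S)), f ≤ a := by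
    intro f hf
    rcases Multiset.mem_add.1 hf with hf | hf
    · exact hF f (by simpa using hf)
    · exact hH f (by simpa using hf)
  induction B generalizing P r with
  | nil => exact sortedConcat_lt_of_forall_le ha hP hr haP (hFH G hG) t
  | cons b B ih =>
    rw [List.cons_append, List.pairwise_cons] at hB
    rcases le_or_gt b a with hba | hba
    · refine sortedConcat_lt_of_forall_le ha hP hr haP (hFH _ fun h hh => ?_) t
      rcases List.mem_cons.1 hh with rfl | hh
      · exact hba
      · exact (hB.1 h hh).trans hba
    · have hb : ∀ f ∈ a ::ₘ ((F : Multiset (List S)) + ((B ++ G : List (List S)) : Multiset _)),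
          f ≤ b := by
        intro f hf
        rcases Multiset.mem_cons.1 hf with rfl | hf
        · exact hba.le
        rcases Multiset.mem_add.1 hf with hf | hf
        · exact (hF f (by simpa using hf)).trans hba.le
        · exact hB.1 f (by simpa using hf)
      rw [List.cons_append, ← Multiset.cons_coe, Multiset.add_cons, Multiset.cons_swap,
        sortedConcat_cons hb]
      rw [List.flatten_cons] at hBr
      rcases lt_trichotomy b r with hbr | rfl | hbr
      · rcases lt_cases hbr with ⟨z, hz, rfl⟩ | h'
        · rw [List.append_assoc]
          rw [append_lt_append_left_iff] at hBr ⊢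
          exact ih (P := P ++ b) (r := z) (by simp [hP]) hz (by simp [haP]) hB.2 hBr
        · exact h' _ _
      · exact absurd hBr (not_lt.2 (le_append _ _))
      · exact absurd (hbr.trans_le (le_append b B.flatten)) (not_lt.2 hBr.le)

/-- If the first Lyndon factor `d` of `v` exceeds the first Lyndon factor of `c :: u`, then a
shuffle of `c :: u` and `v` that takes the letter `c` of `c :: u` first is not the largest one. -/
theorem cons_maxShuffle_lt {c : S} {u v l d : List S} {F G : List (List S)}
    (hl : cfl (c :: u) = l :: G) (hd : cfl v = d :: F) (h : l < d) :
    c :: maxShuffle u v < maxShuffle (c :: u) v := by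
  obtain ⟨B, G', h1, h2, h3, h4, h5⟩ := exists_cfl_cons c u
  rw [h2] at hl
  obtain ⟨rfl, rfl⟩ := List.cons.inj hl
  have hsv := (cfl_spec v).1
  have hdL := (cfl_spec v).2.1 d (by simp [hd])
  rw [hd, List.pairwise_cons] at hsv
  have hG : ∀ g ∈ G', g ≤ d := fun g hg => (h4 g hg).trans h.le
  have hs := (cfl_spec u).1
  rw [h1] at hs
  have hR : maxShuffle (c :: u) v =
      d ++ sortedConcat (((c :: B.flatten) ::ₘ (G' : Multiset (List S))) +
        (F : Multiset (List S))) := by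
    rw [maxShuffle, lyndonFactors, lyndonFactors, h2, hd, ← Multiset.cons_coe, ← Multiset.cons_coe,
      Multiset.add_cons, sortedConcat_cons]
    intro a ha
    rcases Multiset.mem_add.1 ha with ha | ha
    · rcases Multiset.mem_cons.1 ha with rfl | ha
      · exact h.le
      · exact hG a (by simpa using ha)
    · exact hsv.1 a (by simpa using ha)
  have hLHS : maxShuffle u v = sortedConcat (d ::ₘ ((F : Multiset (List S)) +
      ((B ++ G' : List (List S)) : Multiset (List S)))) := by
    rw [maxShuffle, lyndonFactors, lyndonFactors, h1, hd, add_comm, ← Multiset.cons_coe,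
      Multiset.cons_add]
  rw [hR, hLHS]
  cases d with
  | nil => exact absurd rfl hdL.1
  | cons e r =>
    rw [List.cons_append]
    rcases List.cons_lt_cons_iff.1 h with hce | ⟨rfl, hBr⟩
    · exact List.cons_lt_cons_iff.2 (Or.inl hce)
    · refine List.cons_lt_cons_iff.2 (Or.inr ⟨rfl, ?_⟩)
      refine sortedConcat_lt_of_flatten_lt (P := [c]) hdL (by simp) ?_ rfl hsv.1 hG B hs hBr _
      rintro rfl
      exact List.not_lt_nil _ hBr

theorem cfl_cons_ne_nil (c : S) (w : List S) : ∃ l G, cfl (c :: w) = l :: G := by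
  obtain ⟨B, G, -, h, -⟩ := exists_cfl_cons c w
  exact ⟨_, _, h⟩

theorem le_head_of_cfl {w d : List S} {F : List (List S)} (h : cfl w = d :: F) :
    ∀ f ∈ cfl w, f ≤ d := by
  have hs := (cfl_spec w).1
  rw [h, List.pairwise_cons] at hs
  rw [h]
  simpa using hs.1

theorem cons_maxShuffle_le (c : S) (u v : List S) :
    c :: maxShuffle u v ≤ maxShuffle (c :: u) v := by
  obtain ⟨l, G, hl⟩ := cfl_cons_ne_nil c u
  cases v with
  | nil => rw [maxShuffle_nil, maxShuffle_nil]
  | cons b v =>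
    obtain ⟨d, F, hd⟩ := cfl_cons_ne_nil b v
    rcases le_or_gt d l with h | h
    · rw [maxShuffle_cons_of_le hl fun f hf => (le_head_of_cfl hd f hf).trans h]
    · exact (cons_maxShuffle_lt hl hd h).le

theorem IsShuffle.le_maxShuffle {u v s : List S} (h : IsShuffle u v s) : s ≤ maxShuffle u v := by
  induction h with
  | nil => rw [maxShuffle_nil]
  | left _ ih => exact (cons_le_cons_left _ ih).trans (cons_maxShuffle_le _ _ _)
  | @right b u v s _ ih =>
    rw [maxShuffle_comm] at ih ⊢
    exact (cons_le_cons_left _ ih).trans (cons_maxShuffle_le _ _ _)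

theorem isShuffle_maxShuffle (u v : List S) : IsShuffle u v (maxShuffle u v) := by
  induction u generalizing v with
  | nil => rw [nil_maxShuffle]; exact isShuffle_nil_left v
  | cons a u ihu =>
    induction v with
    | nil => rw [maxShuffle_nil]; exact isShuffle_nil_right _
    | cons b v ihv =>
      obtain ⟨l, G, hl⟩ := cfl_cons_ne_nil a u
      obtain ⟨d, F, hd⟩ := cfl_cons_ne_nil b v
      rcases le_total d l with h | h
      · rw [maxShuffle_cons_of_le hl fun f hf => (le_head_of_cfl hd f hf).trans h]
        exact (ihu _).left
      · rw [maxShuffle_comm, maxShuffle_cons_of_le hd fun f hf => (le_head_of_cfl hl f hf).trans h,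
          maxShuffle_comm]
        exact ihv.right

/-- Replacing `u` by a larger word of the same length in a fixed shuffle pattern enlarges the
shuffle. -/
theorem IsShuffle.exists_lt {u v s : List S} (h : IsShuffle u v s) {u' : List S}
    (hl : u'.length = u.length) (hu : u < u') : ∃ s', IsShuffle u' v s' ∧ s < s' := by
  induction h generalizing u' with
  | nil =>
    rw [List.eq_nil_of_length_eq_zero hl] at hu
    exact absurd hu (lt_irrefl _)
  | @left a u v s h ih =>
    cases u' with
    | nil => simp at hl
    | cons a' u' =>
      simp only [List.length_cons, Nat.add_right_cancel_iff] at hl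
      rcases List.cons_lt_cons_iff.1 hu with haa | ⟨rfl, huu⟩
      · have : ∃ s', IsShuffle u' v s' := ⟨_, isShuffle_maxShuffle u' v⟩
        obtain ⟨s', hs'⟩ := this
        exact ⟨a' :: s', hs'.left, List.cons_lt_cons_iff.2 (Or.inl haa)⟩
      · obtain ⟨s', hs', hlt⟩ := ih hl huu
        exact ⟨a :: s', hs'.left, List.cons_lt_cons_iff.2 (Or.inr ⟨rfl, hlt⟩)⟩
  | @right b u v s h ih =>
    obtain ⟨s', hs', hlt⟩ := ih hl hu
    exact ⟨b :: s', hs'.right, List.cons_lt_cons_iff.2 (Or.inr ⟨rfl, hlt⟩)⟩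

theorem length_maxShuffle (u v : List S) : (maxShuffle u v).length = u.length + v.length :=
  (isShuffle_maxShuffle u v).length

theorem maxShuffle_lt_maxShuffle_left {u u' : List S} (hl : u.length = u'.length) (hu : u < u')
    (v : List S) : maxShuffle u v < maxShuffle u' v := by
  obtain ⟨s, hs, hlt⟩ := (isShuffle_maxShuffle u v).exists_lt hl.symm hu
  exact hlt.trans_le hs.le_maxShuffle

end Combinatorics

/-! ### The Frobenius map of the mixable shuffle algebra -/

section Frobenius

variable {k : Type*} [CommRing k] {lam : k} {S : Type*} [CommSemigroup S]

theorem consLin_mul_consLin (a b : S) (x y : MixableShuffle lam S) :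
    consLin lam a x * consLin lam b y = consLin lam a (x * consLin lam b y) +
      consLin lam b (consLin lam a x * y) + lam • consLin lam (a * b) (x * y) :=
  mulLin_cons_cons a b x y

/-- Powers of `a ⊗ x`: the summand with index `i` collects the terms whose first letter is the
product of `i + 1` copies of `a`. -/
theorem consLin_pow_succ (a : S) (x : MixableShuffle lam S) (n : ℕ) :
    consLin lam a x ^ (n + 1) = ∑ i ∈ Finset.range (n + 1), (n + 1).choose (i + 1) •
      lam ^ i • consLin lam (semigroupPow a (i + 1)) (consLin lam a x ^ (n - i) * x ^ (i + 1)) := by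
  induction n with
  | zero => simp [semigroupPow]
  | succ n ih =>
    set y := consLin lam a x with hy
    let f : ℕ → MixableShuffle lam S := fun i =>
      lam ^ i • consLin lam (semigroupPow a (i + 1)) (y ^ (n + 1 - i) * x ^ (i + 1))
    -- `a ⊗ x` times a summand: the new first letter is `a`, the old one, or the product of both
    have step : ∀ i ∈ Finset.range (n + 1),
        y * ((n + 1).choose (i + 1) • lam ^ i • consLin lam (semigroupPow a (i + 1))
            (y ^ (n - i) * x ^ (i + 1))) =
          consLin lam a (x * ((n + 1).choose (i + 1) • lam ^ i •
            consLin lam (semigroupPow a (i + 1)) (y ^ (n - i) * x ^ (i + 1)))) +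
          (n + 1).choose (i + 1) • f i + (n + 1).choose (i + 1) • f (i + 1) := by
      intro i hi
      have hi' : n + 1 - i = n - i + 1 := by
        have := Finset.mem_range.1 hi
        omega
      have h1 : y * (y ^ (n - i) * x ^ (i + 1)) = y ^ (n + 1 - i) * x ^ (i + 1) := by
        rw [hi']; ring
      have h2 : x * (y ^ (n - i) * x ^ (i + 1)) = y ^ (n + 1 - (i + 1)) * x ^ (i + 1 + 1) := by
        rw [show n + 1 - (i + 1) = n - i by omega]; ring
      have h3 : a * semigroupPow a (i + 1) = semigroupPow a (i + 1 + 1) := by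
        rw [mul_comm]; rfl
      have h4 := consLin_mul_consLin a (semigroupPow a (i + 1)) x (y ^ (n - i) * x ^ (i + 1))
      rw [← hy, h1, h2, h3] at h4
      simp only [f, mul_smul_comm, map_nsmul, map_smul]
      rw [h4]
      simp only [smul_add, smul_smul, pow_succ]
    have hf0 : consLin lam a (x * y ^ (n + 1)) = f 0 := by
      simp [f, semigroupPow, mul_comm]
    rw [pow_succ' y (n + 1), ih, Finset.mul_sum, Finset.sum_congr rfl step, Finset.sum_add_distrib,
      Finset.sum_add_distrib, ← map_sum, ← Finset.mul_sum, ← ih, hf0]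
    change _ = ∑ i ∈ Finset.range (n + 1 + 1), (n + 1 + 1).choose (i + 1) • f i
    have pascal : ∀ i ∈ Finset.range (n + 1 + 1), (n + 1 + 1).choose (i + 1) • f i =
        (n + 1).choose i • f i + (n + 1).choose (i + 1) • f i := by
      intro i _
      rw [Nat.choose_succ_succ, add_smul]
    rw [Finset.sum_congr rfl pascal, Finset.sum_add_distrib,
      Finset.sum_range_succ' (fun i => (n + 1).choose i • f i),
      Finset.sum_range_succ (fun i => (n + 1).choose (i + 1) • f i) (n + 1)]
    simp only [Nat.choose_zero_right, one_smul, Nat.choose_succ_self, zero_smul, add_zero]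
    abel

variable (p : ℕ) [Fact p.Prime]

theorem lam_pow_eq_one {lam : ZMod p} (hlam : lam ≠ 0) (n : ℕ) : lam ^ ((p - 1) * n) = 1 := by
  rw [pow_mul, ZMod.pow_card_sub_one_eq_one hlam, one_pow]

variable {lam : ZMod p}

theorem consLin_pow_prime (hlam : lam ≠ 0) (a : S) (x : MixableShuffle lam S) :
    consLin lam a x ^ p = consLin lam (semigroupPow a p) (x ^ p) := by
  have hp := (Fact.out : p.Prime)
  obtain ⟨n, hn⟩ : ∃ n, p = n + 1 := ⟨p - 1, (Nat.succ_pred_prime hp).symm⟩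
  have h := consLin_pow_succ a x n
  rw [← hn] at h
  rw [h, Finset.sum_eq_single (p - 1)]
  · have h1 : p - 1 + 1 = p := by omega
    have h2 : n - (p - 1) = 0 := by omega
    rw [h1, h2, Nat.choose_self, one_smul, ZMod.pow_card_sub_one_eq_one hlam, one_smul, pow_zero,
      one_mul]
  · intro i hi hne
    have hi' := Finset.mem_range.1 hi
    have hdvd : p ∣ p.choose (i + 1) := hp.dvd_choose_self (by omega) (by omega)
    rw [← Nat.cast_smul_eq_nsmul (ZMod p), (ZMod.natCast_eq_zero_iff _ _).2 hdvd, zero_smul]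
  · intro h
    exact absurd (Finset.mem_range.2 (by omega)) h

/-- The Frobenius map sends the word `w` to the word `w^(p)`. -/
theorem word_pow_prime (hlam : lam ≠ 0) (w : List S) :
    word lam w ^ p = word lam (wordFrob p w) := by
  induction w with
  | nil => exact one_pow p
  | cons a w ih => rw [← consLin_word, consLin_pow_prime p hlam, ih, consLin_word]; rfl

end Frobenius

/-! ### Leading words -/

section Leading

/-- Words are compared by length first, and lexicographically in equal length. -/
def wordKey {S : Type*} (w : List S) : ℕ ×ₗ List S := toLex (w.length, w)

theorem wordKey_injective {S : Type*} :
    Function.Injective (wordKey : List S → ℕ ×ₗ List S) := fun _ _ h =>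
  congrArg (fun x => (ofLex x).2) h

variable {S : Type*} [LinearOrder S]

theorem wordKey_lt_iff {v w : List S} :
    wordKey v < wordKey w ↔ v.length < w.length ∨ v.length = w.length ∧ v < w :=
  Prod.Lex.lt_iff

theorem wellFounded_wordKey [WellFoundedLT S] :
    WellFounded fun v w : List S => wordKey v < wordKey w := by
  refine Subrelation.wf (fun {v w} h => ?_) (List.Shortlex.wf (wellFounded_lt (α := S)))
  exact List.shortlex_def.2 (wordKey_lt_iff.1 h)

theorem wordKey_cons_lt_cons (a : S) {v w : List S} (h : wordKey v < wordKey w) :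
    wordKey (a :: v) < wordKey (a :: w) := by
  rw [wordKey_lt_iff] at h ⊢
  rcases h with h | ⟨h1, h2⟩
  · left; simpa using h
  · right
    exact ⟨by simpa using h1, List.cons_lt_cons_iff.2 (Or.inr ⟨rfl, h2⟩)⟩

theorem wordKey_maxShuffle_lt_left {u u' : List S} (h : wordKey u < wordKey u') (v : List S) :
    wordKey (maxShuffle u v) < wordKey (maxShuffle u' v) := by
  rw [wordKey_lt_iff] at h ⊢
  rw [length_maxShuffle, length_maxShuffle]
  rcases h with h | ⟨h1, h2⟩
  · left; omega
  · exact Or.inr ⟨by omega, maxShuffle_lt_maxShuffle_left h1 h2 v⟩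

theorem wordKey_maxShuffle_lt_right (u : List S) {v v' : List S} (h : wordKey v < wordKey v') :
    wordKey (maxShuffle u v) < wordKey (maxShuffle u v') := by
  rw [maxShuffle_comm u, maxShuffle_comm u]
  exact wordKey_maxShuffle_lt_left h u

/-- The number of ways to obtain the largest shuffle of two words with given Chen–Fox–Lyndon
factorizations: a larger first factor has to come first, and equal first factors can come in either
order. -/
def shuffleMultiplicity : List (List S) → List (List S) → ℕ
  | [], _ => 1
  | _ :: _, [] => 1
  | a :: F, d :: G =>
      if d < a then shuffleMultiplicity F (d :: G)
      else if a < d then shuffleMultiplicity (a :: F) G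
      else shuffleMultiplicity F (d :: G) + shuffleMultiplicity (a :: F) G
termination_by F G => F.length + G.length

theorem shuffleMultiplicity_nil (F : List (List S)) : shuffleMultiplicity F [] = 1 := by
  cases F <;> simp [shuffleMultiplicity]

theorem shuffleMultiplicity_append_left {B : List (List S)} {d : List S} (hB : ∀ b ∈ B, d < b)
    (F G : List (List S)) :
    shuffleMultiplicity (B ++ F) (d :: G) = shuffleMultiplicity F (d :: G) := by
  induction B with
  | nil => rfl
  | cons b B ih =>
    rw [List.cons_append, shuffleMultiplicity, if_pos (hB b (by simp)),
      ih fun b hb => hB b (by simp [hb])]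

theorem shuffleMultiplicity_append_right {B : List (List S)} {a : List S} (hB : ∀ b ∈ B, a < b)
    (F G : List (List S)) :
    shuffleMultiplicity (a :: F) (B ++ G) = shuffleMultiplicity (a :: F) G := by
  induction B with
  | nil => rfl
  | cons b B ih =>
    rw [List.cons_append, shuffleMultiplicity, if_neg (hB b (by simp)).le.not_gt,
      if_pos (hB b (by simp)), ih fun b hb => hB b (by simp [hb])]

theorem shuffleMultiplicity_replicate {F : List (List S)} (hF : F.Pairwise (· ≥ ·)) (l : List S)
    (m : ℕ) : shuffleMultiplicity F (List.replicate m l) =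
      ((F : Multiset (List S)).count l + m).choose m := by
  induction F generalizing m with
  | nil => simp [shuffleMultiplicity]
  | cons a F ih =>
    rw [List.pairwise_cons] at hF
    induction m with
    | zero => simp [shuffleMultiplicity_nil]
    | succ m ihm =>
      rw [List.replicate_succ, shuffleMultiplicity]
      rcases lt_trichotomy l a with h | rfl | h
      · rw [if_pos h, ← Multiset.cons_coe, Multiset.count_cons_of_ne h.ne, ← List.replicate_succ,
          ih hF.2]
      · rw [if_neg (lt_irrefl _), if_neg (lt_irrefl _), ← List.replicate_succ, ih hF.2, ihm,
          ← Multiset.cons_coe, Multiset.count_cons_self]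
        generalize (F : Multiset (List S)).count l = n
        rw [show n + 1 + (m + 1) = n + 1 + m + 1 by omega, Nat.choose_succ_succ',
          show n + (m + 1) = n + 1 + m by omega, add_comm]
      · rw [if_neg h.le.not_gt, if_pos h, ihm]
        have hl : ((a :: F : List (List S)) : Multiset (List S)).count l = 0 := by
          rw [Multiset.count_eq_zero, Multiset.mem_coe]
          intro hl
          rcases List.mem_cons.1 hl with rfl | hl
          · exact lt_irrefl _ h
          · exact absurd (hF.1 l hl) (not_le.2 h)
        rw [hl]
        simp

variable {k : Type*} [CommRing k] (lam : k)

/-- The span of the words that are smaller than `w`. -/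
noncomputable def lowerWords (w : List S) : Submodule k (MixableShuffle lam S) :=
  Submodule.span k (word lam '' {v | wordKey v < wordKey w})

variable {lam}

theorem word_mem_lowerWords {v w : List S} (h : wordKey v < wordKey w) :
    word lam v ∈ lowerWords lam w := Submodule.subset_span ⟨v, h, rfl⟩

theorem lowerWords_mono {v w : List S} (h : wordKey v < wordKey w) :
    lowerWords lam v ≤ lowerWords lam w := by
  refine Submodule.span_mono (Set.image_mono fun u hu => ?_)
  exact lt_trans (show wordKey u < wordKey v from hu) h

theorem consLin_mem_lowerWords (a : S) {w : List S} {x : MixableShuffle lam S}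
    (hx : x ∈ lowerWords lam w) : consLin lam a x ∈ lowerWords lam (a :: w) := by
  have h : (lowerWords lam w).map (consLin lam a) ≤ lowerWords lam (a :: w) := by
    rw [lowerWords, Submodule.map_span_le]
    rintro _ ⟨v, hv, rfl⟩
    rw [consLin_word]
    exact word_mem_lowerWords (wordKey_cons_lt_cons a hv)
  exact h ⟨x, hx, rfl⟩

/-- `x` is `c` times the word `w` plus a combination of smaller words. -/
def HasLead (x : MixableShuffle lam S) (w : List S) (c : k) : Prop :=
  x - c • word lam w ∈ lowerWords lam w

theorem hasLead_word (w : List S) : HasLead (word lam w) w 1 := by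
  simp [HasLead]

theorem HasLead.add {x y : MixableShuffle lam S} {w : List S} {c d : k} (hx : HasLead x w c)
    (hy : HasLead y w d) : HasLead (x + y) w (c + d) := by
  have h := add_mem hx hy
  rw [HasLead]
  convert h using 1
  module

theorem HasLead.smul {x : MixableShuffle lam S} {w : List S} {c : k} (hx : HasLead x w c) (d : k) :
    HasLead (d • x) w (d * c) := by
  have h := Submodule.smul_mem _ d hx
  rw [HasLead]
  convert h using 1
  module

theorem HasLead.mem_lowerWords {x : MixableShuffle lam S} {v w : List S} {c : k}
    (hx : HasLead x v c) (h : wordKey v < wordKey w) : x ∈ lowerWords lam w := by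
  have h1 := add_mem (lowerWords_mono h hx) (Submodule.smul_mem _ c (word_mem_lowerWords h))
  simpa using h1

theorem hasLead_zero {x : MixableShuffle lam S} {w : List S} :
    HasLead x w 0 ↔ x ∈ lowerWords lam w := by
  simp [HasLead]

theorem HasLead.consLin {x : MixableShuffle lam S} {w : List S} {c : k} (hx : HasLead x w c)
    (a : S) : HasLead (consLin lam a x) (a :: w) c := by
  have h := consLin_mem_lowerWords a hx
  simpa [HasLead] using h

/-- The product of two words is a multiple of their largest shuffle plus smaller words. -/
theorem hasLead_mulWord [CommSemigroup S] (n : ℕ) (u v : List S) (h : u.length + v.length ≤ n) :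
    HasLead (mulWord lam u v) (maxShuffle u v) (shuffleMultiplicity (cfl u) (cfl v) : k) := by
  induction n generalizing u v with
  | zero =>
    obtain ⟨rfl, rfl⟩ : u = [] ∧ v = [] := by
      constructor <;> apply List.eq_nil_of_length_eq_zero <;> omega
    simpa [mulWord, maxShuffle_nil, cfl, shuffleMultiplicity] using hasLead_word []
  | succ n ih =>
    cases u with
    | nil => simpa [mulWord, nil_maxShuffle, cfl, shuffleMultiplicity] using hasLead_word v
    | cons a u =>
      cases v with
      | nil =>
        simpa [mulWord, maxShuffle_nil, cfl, shuffleMultiplicity_nil] using hasLead_word (a :: u)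
      | cons b v =>
        simp only [List.length_cons] at h
        have h1 := (ih u (b :: v) (by simp only [List.length_cons]; omega)).consLin a
        have h2 := (ih (a :: u) v (by simp only [List.length_cons]; omega)).consLin b
        -- merging the first letters gives shorter words only
        have h3 : lam • MixableShuffle.consLin lam (a * b) (mulWord lam u v) ∈
            lowerWords lam (maxShuffle (a :: u) (b :: v)) := by
          refine Submodule.smul_mem _ _ (((ih u v (by omega)).consLin (a * b)).mem_lowerWords ?_)
          rw [wordKey_lt_iff, List.length_cons, length_maxShuffle, length_maxShuffle]
          left
          simp only [List.length_cons]
          omega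
        rw [mulWord]
        obtain ⟨B, G, hu1, hu2, -, hu4, hu5⟩ := exists_cfl_cons a u
        obtain ⟨C, H, hv1, hv2, -, hv4, hv5⟩ := exists_cfl_cons b v
        have hle1 : ∀ f ∈ cfl (a :: u), f ≤ a :: B.flatten := le_head_of_cfl hu2
        have hle2 : ∀ f ∈ cfl (b :: v), f ≤ b :: C.flatten := le_head_of_cfl hv2
        have hlen1 : (a :: maxShuffle u (b :: v)).length = (maxShuffle (a :: u) (b :: v)).length := by
          simp only [List.length_cons, length_maxShuffle]
          omega
        have hlen2 : (b :: maxShuffle (a :: u) v).length = (maxShuffle (a :: u) (b :: v)).length := by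
          simp only [List.length_cons, length_maxShuffle]
          omega
        -- the two possible first letters of a shuffle, when they lead to the largest one
        have e1 (hle : b :: C.flatten ≤ a :: B.flatten) :
            maxShuffle (a :: u) (b :: v) = a :: maxShuffle u (b :: v) :=
          maxShuffle_cons_of_le hu2 fun f hf => (hle2 f hf).trans hle
        have c1 (hle : b :: C.flatten ≤ a :: B.flatten) :
            shuffleMultiplicity (cfl u) (cfl (b :: v)) = shuffleMultiplicity G (cfl (b :: v)) := by
          rw [hu1, hv2, shuffleMultiplicity_append_left fun f hf => hle.trans_lt (hu5 f hf)]
        have e2 (hle : a :: B.flatten ≤ b :: C.flatten) :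
            maxShuffle (a :: u) (b :: v) = b :: maxShuffle (a :: u) v := by
          rw [maxShuffle_comm, maxShuffle_cons_of_le hv2 fun f hf => (hle1 f hf).trans hle,
            maxShuffle_comm]
        have c2 (hle : a :: B.flatten ≤ b :: C.flatten) :
            shuffleMultiplicity (cfl (a :: u)) (cfl v) = shuffleMultiplicity (cfl (a :: u)) H := by
          rw [hv1, hu2, shuffleMultiplicity_append_right fun f hf => hle.trans_lt (hv5 f hf)]
        rcases lt_trichotomy (b :: C.flatten) (a :: B.flatten) with hlt | heq | hlt
        · rw [c1 hlt.le, ← e1 hlt.le] at h1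
          have h2' := h2.mem_lowerWords (w := maxShuffle (a :: u) (b :: v)) (by
            rw [wordKey_lt_iff]
            refine Or.inr ⟨hlen2, ?_⟩
            rw [maxShuffle_comm _ v, maxShuffle_comm _ (b :: v)]
            exact cons_maxShuffle_lt hv2 hu2 hlt)
          have := (h1.add (hasLead_zero.2 h2')).add (hasLead_zero.2 h3)
          rw [add_zero, add_zero, hv2] at this
          rwa [hu2, hv2, shuffleMultiplicity, if_pos hlt]
        · rw [c1 heq.le, ← e1 heq.le] at h1
          rw [c2 heq.ge, ← e2 heq.ge] at h2
          have := (h1.add h2).add (hasLead_zero.2 h3)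
          rw [add_zero, hv2, hu2, ← Nat.cast_add] at this
          rwa [hu2, hv2, shuffleMultiplicity, if_neg (by rw [heq]; exact lt_irrefl _),
            if_neg (by rw [heq]; exact lt_irrefl _)]
        · rw [c2 hlt.le, ← e2 hlt.le] at h2
          have h1' := h1.mem_lowerWords (w := maxShuffle (a :: u) (b :: v)) (by
            rw [wordKey_lt_iff]
            exact Or.inr ⟨hlen1, cons_maxShuffle_lt hu2 hv2 hlt⟩)
          have := ((hasLead_zero.2 h1').add h2).add (hasLead_zero.2 h3)
          rw [zero_add, add_zero, hu2] at this
          rwa [hu2, hv2, shuffleMultiplicity, if_neg hlt.le.not_gt, if_pos hlt]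

theorem hasLead_word_mul_word [CommSemigroup S] (u v : List S) :
    HasLead (word lam u * word lam v) (maxShuffle u v)
      (shuffleMultiplicity (cfl u) (cfl v) : k) := by
  rw [word_mul_word]
  exact hasLead_mulWord _ u v le_rfl

theorem mul_mem_lowerWords [CommSemigroup S] {x y : MixableShuffle lam S} {w : List S}
    {U V : Set (List S)} (hx : x ∈ Submodule.span k (word lam '' U))
    (hy : y ∈ Submodule.span k (word lam '' V))
    (h : ∀ u ∈ U, ∀ v ∈ V, wordKey (maxShuffle u v) < wordKey w) : x * y ∈ lowerWords lam w := by
  have hxy := Submodule.mul_mem_mul hx hy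
  rw [Submodule.span_mul_span] at hxy
  refine Submodule.span_le.2 ?_ hxy
  rintro _ ⟨_, ⟨u, hu, rfl⟩, _, ⟨v, hv, rfl⟩, rfl⟩
  exact (hasLead_word_mul_word u v).mem_lowerWords (h u hu v hv)

theorem HasLead.mul [CommSemigroup S] {x y : MixableShuffle lam S} {u v : List S} {c d : k}
    (hx : HasLead x u c) (hy : HasLead y v d) :
    HasLead (x * y) (maxShuffle u v) (c * d * (shuffleMultiplicity (cfl u) (cfl v) : k)) := by
  have hw (w : List S) : word lam w ∈ Submodule.span k (word lam '' {w}) :=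
    Submodule.subset_span ⟨w, rfl, rfl⟩
  have h1 : (x - c • word lam u) * (y - d • word lam v) ∈ lowerWords lam (maxShuffle u v) :=
    mul_mem_lowerWords hx hy fun u' hu v' hv =>
      (wordKey_maxShuffle_lt_left hu v').trans (wordKey_maxShuffle_lt_right u hv)
  have h2 : (x - c • word lam u) * word lam v ∈ lowerWords lam (maxShuffle u v) := by
    refine mul_mem_lowerWords hx (hw v) ?_
    rintro u' hu _ rfl
    exact wordKey_maxShuffle_lt_left hu _
  have h3 : word lam u * (y - d • word lam v) ∈ lowerWords lam (maxShuffle u v) := by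
    refine mul_mem_lowerWords (hw u) hy ?_
    rintro _ rfl v' hv
    exact wordKey_maxShuffle_lt_right _ hv
  have h4 := (hasLead_word_mul_word (lam := lam) u v).smul (c * d)
  have h5 := h4.add (hasLead_zero.2 (add_mem (add_mem h1 (Submodule.smul_mem _ d h2))
    (Submodule.smul_mem _ c h3)))
  rw [add_zero] at h5
  convert h5 using 1
  simp only [sub_mul, mul_sub, smul_sub, smul_mul_assoc, mul_smul_comm, smul_smul]
  rw [mul_comm d c]
  abel

end Leading

/-! ### Triangular families -/

section Triangular

variable {k : Type*} [CommRing k] {lam : k} {S : Type*} [LinearOrder S]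

/-- The coefficient of a word. -/
noncomputable def wordCoeff {S : Type*} (lam : k) (w : List S) : MixableShuffle lam S →ₗ[k] k :=
  (Finsupp.lapply w : (List S →₀ k) →ₗ[k] k)

theorem wordCoeff_word_self {S : Type*} (w : List S) : wordCoeff lam w (word lam w) = 1 :=
  Finsupp.single_eq_same

theorem wordCoeff_word_of_ne {S : Type*} {v w : List S} (h : v ≠ w) :
    wordCoeff lam w (word lam v) = 0 := Finsupp.single_eq_of_ne h.symm

theorem wordCoeff_eq_zero {x : MixableShuffle lam S} {v w : List S} (hx : x ∈ lowerWords lam v)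
    (h : wordKey v ≤ wordKey w) : wordCoeff lam w x = 0 := by
  have : lowerWords lam v ≤ LinearMap.ker (wordCoeff lam w) := by
    refine Submodule.span_le.2 ?_
    rintro _ ⟨u, hu, rfl⟩
    have huw : wordKey u < wordKey w := lt_of_lt_of_le hu h
    exact wordCoeff_word_of_ne fun e => huw.ne (congrArg wordKey e)
  exact this hx

theorem HasLead.wordCoeff_self {x : MixableShuffle lam S} {w : List S} {c : k}
    (hx : HasLead x w c) : wordCoeff lam w x = c := by
  have h := wordCoeff_eq_zero hx le_rfl
  rw [map_sub, map_smul, wordCoeff_word_self, smul_eq_mul, mul_one, sub_eq_zero] at h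
  exact h

theorem HasLead.wordCoeff_eq_zero {x : MixableShuffle lam S} {v w : List S} {c : k}
    (hx : HasLead x v c) (h : wordKey v < wordKey w) : wordCoeff lam w x = 0 :=
  MixableShuffle.wordCoeff_eq_zero (hx.mem_lowerWords h) le_rfl

theorem span_word {S : Type*} :
    Submodule.span k (Set.range (word lam : List S → MixableShuffle lam S)) = ⊤ := by
  have h := (Finsupp.basisSingleOne (R := k) (ι := List S)).span_eq
  rw [Finsupp.coe_basisSingleOne] at h
  exact h

/-- A family with distinct leading words is linearly independent. -/
theorem linearIndependent_of_hasLead [IsDomain k] {ι : Type*} {x : ι → MixableShuffle lam S}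
    {φ : ι → List S} (hφ : Function.Injective φ)
    (hx : ∀ i, ∃ c, c ≠ 0 ∧ HasLead (x i) (φ i) c) : LinearIndependent k x := by
  classical
  rw [linearIndependent_iff']
  intro s a hsum
  by_contra! hne
  obtain ⟨j, hjs, hj⟩ := hne
  obtain ⟨i, hi, hmax⟩ := Finset.exists_max_image (s.filter fun i => a i ≠ 0)
    (fun i => wordKey (φ i)) ⟨j, Finset.mem_filter.2 ⟨hjs, hj⟩⟩
  rw [Finset.mem_filter] at hi
  obtain ⟨c, hc, hlead⟩ := hx i
  have h := congrArg (wordCoeff lam (φ i)) hsum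
  rw [map_sum, map_zero, Finset.sum_eq_single i] at h
  · rw [map_smul, hlead.wordCoeff_self, smul_eq_mul] at h
    exact mul_ne_zero hi.2 hc h
  · intro i' hi' hii
    by_cases ha : a i' = 0
    · simp [ha]
    · obtain ⟨c', -, hlead'⟩ := hx i'
      have hle := hmax i' (Finset.mem_filter.2 ⟨hi', ha⟩)
      have hlt := lt_of_le_of_ne hle fun e => hii (hφ (wordKey_injective e))
      rw [map_smul, hlead'.wordCoeff_eq_zero hlt, smul_zero]
  · exact fun h => absurd hi.1 h

end Triangular

/-! ### Base `p` arithmetic -/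

section Digits

theorem sum_div_pow_mod {p : ℕ} (d : ℕ → ℕ) (hd : ∀ i, d i < p) (N : ℕ)
    (hN : ∀ i, N ≤ i → d i = 0) (j : ℕ) :
    (∑ i ∈ Finset.range N, d i * p ^ i) / p ^ j % p = d j := by
  have hp : 0 < p := (Nat.zero_le _).trans_lt (hd 0)
  induction j generalizing d N with
  | zero =>
    cases N with
    | zero => simp [hN 0 le_rfl]
    | succ N =>
      simp only [Finset.sum_range_succ', pow_succ, pow_zero, mul_one, Nat.div_one,
        ← mul_assoc, ← Finset.sum_mul]
      rw [Nat.mul_add_mod_self_right, Nat.mod_eq_of_lt (hd 0)]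
  | succ j ih =>
    cases N with
    | zero => simp [hN (j + 1) (Nat.zero_le _)]
    | succ N =>
      rw [← ih (fun i => d (i + 1)) (fun i => hd _) N (fun i hi => hN _ (by omega)), pow_succ' p j,
        ← Nat.div_div_eq_div_mul]
      simp only [Finset.sum_range_succ', pow_succ, pow_zero, mul_one, ← mul_assoc, ← Finset.sum_mul]
      rw [Nat.add_comm, Nat.add_mul_div_right _ _ hp, Nat.div_eq_of_lt (hd 0), zero_add]

theorem choose_prime_pow_modEq (p : ℕ) [Fact p.Prime] (n i : ℕ) :
    n.choose (p ^ i) ≡ n / p ^ i [MOD p] := by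
  have hp := (Fact.out : p.Prime).pos
  induction i generalizing n with
  | zero => simp [Nat.ModEq.refl]
  | succ i ih =>
    have h := Choose.choose_modEq_choose_mod_mul_choose_div_nat (p := p) (n := n) (k := p ^ (i + 1))
    rw [pow_succ', Nat.mul_mod_right, Nat.mul_div_cancel_left _ hp, Nat.choose_zero_right,
      one_mul] at h
    rw [pow_succ', ← Nat.div_div_eq_div_mul]
    exact h.trans (ih _)

end Digits

/-! ### The monomials in tensor powers of Lyndon words -/

section Monomials

theorem wordPow_ne_nil {S : Type*} {l : List S} (hl : l ≠ []) {n : ℕ} (hn : n ≠ 0) :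
    wordPow l n ≠ [] := by
  obtain ⟨m, rfl⟩ := Nat.exists_eq_succ_of_ne_zero hn
  simp [wordPow, List.replicate_succ, hl]

theorem length_wordPow {S : Type*} (l : List S) (n : ℕ) :
    (wordPow l n).length = n * l.length := by
  simp [wordPow]

theorem wordPow_injective {S : Type*} {l : List S} (hl : l ≠ []) :
    Function.Injective (wordPow l) := by
  intro m n h
  have h' := congrArg List.length h
  rw [length_wordPow, length_wordPow] at h'
  exact Nat.eq_of_mul_eq_mul_right (List.length_pos_of_ne_nil hl) h'

/-- The monomial `∏ g w ^ e w`. -/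
noncomputable def wordMonomial {S A : Type*} [CommMonoid A] (g : List S → A) (e : List S →₀ ℕ) :
    A :=
  e.prod fun w m => g w ^ m

theorem wordMonomial_add {S A : Type*} [CommMonoid A] (g : List S → A) (e e' : List S →₀ ℕ) :
    wordMonomial g (e + e') = wordMonomial g e * wordMonomial g e' :=
  Finsupp.prod_add_index' (fun _ => pow_zero _) fun _ _ _ => pow_add _ _ _

theorem wordMonomial_single {S A : Type*} [CommMonoid A] (g : List S → A) (w : List S) (n : ℕ) :
    wordMonomial g (Finsupp.single w n) = g w ^ n :=
  Finsupp.prod_single_index (pow_zero _)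

variable {S : Type*} [LinearOrder S]

theorem cfl_wordPow {l : List S} (hl : l ∈ lyndonWords S) (n : ℕ) :
    cfl (wordPow l n) = List.replicate n l := by
  rw [wordPow, cfl_flatten]
  · exact List.pairwise_replicate.2 (Or.inr le_rfl)
  · intro f hf
    rwa [List.eq_of_mem_replicate hf]

theorem lyndonFactors_wordPow {l : List S} (hl : l ∈ lyndonWords S) (n : ℕ) :
    lyndonFactors (wordPow l n) = Multiset.replicate n l := by
  rw [lyndonFactors, cfl_wordPow hl, Multiset.coe_replicate]

variable (p : ℕ) [Fact p.Prime]

/-- The exponent vectors supported in the tensor powers `l ^ ⊗ p ^ i` of Lyndon words `l`, with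
all exponents less than `p`. -/
def reducedExponents (p : ℕ) (S : Type*) [LinearOrder S] : Set (List S →₀ ℕ) :=
  {e | ∀ w, e w ≠ 0 → w ∈ tensorPowers p (lyndonWords S) ∧ e w < p}

/-- The Lyndon factors of the leading word of the monomial with exponent vector `e`. -/
def exponentFactors (e : List S →₀ ℕ) : Multiset (List S) :=
  e.sum fun w m => m • lyndonFactors w

theorem exponentFactors_mem {e : List S →₀ ℕ} : ∀ f ∈ exponentFactors e, f ∈ lyndonWords S := by
  intro f hf
  rw [exponentFactors, Finsupp.sum, Multiset.mem_sum] at hf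
  obtain ⟨w, -, hw⟩ := hf
  exact lyndonFactors_subset w f (Multiset.mem_of_mem_nsmul hw)

/-- The multiplicity of `l` in the leading word has the exponents of the `l ^ ⊗ p ^ i` as its
digits in base `p`. -/
theorem count_exponentFactors_digit {e : List S →₀ ℕ} (he : e ∈ reducedExponents p S) {l : List S}
    (hl : l ∈ lyndonWords S) (j : ℕ) :
    (exponentFactors e).count l / p ^ j % p = e (wordPow l (p ^ j)) := by
  have hp := (Fact.out : p.Prime)
  set N := e.support.sup List.length with hN
  have hinj : Function.Injective fun i => wordPow l (p ^ i) :=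
    (wordPow_injective hl.1).comp (Nat.pow_right_injective hp.two_le)
  have hlen : ∀ i, N ≤ i → e (wordPow l (p ^ i)) = 0 := by
    intro i hi
    by_contra h
    have h1 : (wordPow l (p ^ i)).length ≤ N :=
      Finset.le_sup (f := List.length) (Finsupp.mem_support_iff.2 h)
    rw [length_wordPow] at h1
    have h2 := Nat.lt_pow_self hp.one_lt (n := i)
    have h3 := Nat.le_mul_of_pos_right (p ^ i) (List.length_pos_of_ne_nil hl.1)
    omega
  have hsum : (exponentFactors e).count l = ∑ i ∈ Finset.range N, e (wordPow l (p ^ i)) * p ^ i := by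
    rw [exponentFactors, Finsupp.sum, Multiset.count_sum']
    simp only [Multiset.count_nsmul]
    symm
    refine Finset.sum_bij_ne_zero (fun i _ _ => wordPow l (p ^ i)) ?_ ?_ ?_ ?_
    · intro i _ h
      exact Finsupp.mem_support_iff.2 (left_ne_zero_of_mul h)
    · intro i _ _ j _ _ h
      exact hinj h
    · intro w hw hne
      obtain ⟨l', hl', i, rfl⟩ := (he w (Finsupp.mem_support_iff.1 hw)).1
      have hcount := right_ne_zero_of_mul hne
      rw [lyndonFactors_wordPow hl', Multiset.count_replicate] at hcount
      obtain rfl : l' = l := by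
        by_contra h
        simp [h] at hcount
      have hi : i < N := by
        by_contra h
        exact Finsupp.mem_support_iff.1 hw (hlen i (not_lt.1 h))
      exact ⟨i, Finset.mem_range.2 hi, mul_ne_zero (Finsupp.mem_support_iff.1 hw)
        (pow_pos hp.pos i).ne', rfl⟩
    · intro i _ _
      rw [lyndonFactors_wordPow hl, Multiset.count_replicate_self]
  rw [hsum, sum_div_pow_mod (fun i => e (wordPow l (p ^ i))) ?_ N hlen]
  intro i
  by_cases h : e (wordPow l (p ^ i)) = 0
  · simp only [h]
    exact hp.pos
  · exact (he _ h).2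

theorem exponentFactors_injOn : Set.InjOn exponentFactors (reducedExponents p S) := by
  intro e he e' he' h
  have key : ∀ l ∈ lyndonWords S, ∀ i : ℕ, e (wordPow l (p ^ i)) = e' (wordPow l (p ^ i)) := by
    intro l hl i
    rw [← count_exponentFactors_digit p he hl, ← count_exponentFactors_digit p he' hl, h]
  ext w
  by_cases hw : w ∈ tensorPowers p (lyndonWords S)
  · obtain ⟨l, hl, i, rfl⟩ := hw
    exact key l hl i
  · rw [not_not.1 (mt (fun h => (he w h).1) hw), not_not.1 (mt (fun h => (he' w h).1) hw)]

variable {lam : ZMod p} [CommSemigroup S]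

/-- Multiplying by an element led by a tensor power `l ^ ⊗ p ^ i` of a Lyndon word. The
coefficient comes from the binomial coefficient `(n + p ^ i).choose (p ^ i)`, where `n` is the
multiplicity of `l`. -/
theorem HasLead.mul_wordPow {x y : MixableShuffle lam S} {m : Multiset (List S)}
    (hm : ∀ f ∈ m, f ∈ lyndonWords S) {c : ZMod p} (hx : HasLead x (sortedConcat m) c)
    {l : List S} (hl : l ∈ lyndonWords S) {i : ℕ} (hy : HasLead y (wordPow l (p ^ i)) 1) :
    HasLead (x * y) (sortedConcat (m + Multiset.replicate (p ^ i) l))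
      (c * ((m.count l / p ^ i + 1 : ℕ) : ZMod p)) := by
  have h := hx.mul hy
  have hp : 0 < p ^ i := pow_pos (Fact.out : p.Prime).pos i
  have hc : ((shuffleMultiplicity (cfl (sortedConcat m)) (cfl (wordPow l (p ^ i))) : ℕ) : ZMod p) =
      ((m.count l / p ^ i + 1 : ℕ) : ZMod p) := by
    have h1 : (cfl (sortedConcat m) : Multiset (List S)) = m := lyndonFactors_sortedConcat hm
    rw [cfl_wordPow hl, shuffleMultiplicity_replicate (cfl_spec _).1, h1,
      ZMod.natCast_eq_natCast_iff, ← Nat.add_div_right _ hp]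
    exact choose_prime_pow_modEq p _ _
  rw [hc, mul_one, maxShuffle, lyndonFactors_sortedConcat hm, lyndonFactors_wordPow hl] at h
  exact h

/-- Elements led by the tensor powers `l ^ ⊗ p ^ i` of Lyndon words generate the algebra. -/
theorem adjoin_eq_top [WellFoundedLT S] {g : List S → MixableShuffle lam S}
    (hg : ∀ w ∈ tensorPowers p (lyndonWords S), HasLead (g w) w 1) :
    Algebra.adjoin (ZMod p) (g '' tensorPowers p (lyndonWords S)) = ⊤ := by
  set A := Algebra.adjoin (ZMod p) (g '' tensorPowers p (lyndonWords S)) with hA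
  have hp := (Fact.out : p.Prime)
  have hword : ∀ u : List S, word lam u ∈ A := by
    intro u
    refine wellFounded_wordKey.induction (C := fun u => word lam u ∈ A) u fun u ih => ?_
    rcases eq_or_ne u [] with rfl | hu
    · exact one_mem A
    have hlow : ∀ x ∈ lowerWords lam u, x ∈ A := by
      intro x hx
      have : lowerWords lam u ≤ Subalgebra.toSubmodule A := by
        refine Submodule.span_le.2 ?_
        rintro _ ⟨v, hv, rfl⟩
        exact ih v hv
      exact this hx
    obtain ⟨c, u, rfl⟩ := List.exists_cons_of_ne_nil hu
    obtain ⟨l, G, hlG⟩ := cfl_cons_ne_nil c u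
    have hl : l ∈ lyndonFactors (c :: u) := by simp [lyndonFactors, hlG]
    have hlL := lyndonFactors_subset _ l hl
    set n := (lyndonFactors (c :: u)).count l with hn
    have hn0 : n ≠ 0 := (Multiset.count_pos.2 hl).ne'
    -- `p ^ i` is the largest power of `p` that is at most the multiplicity of `l`
    set i := Nat.log p n with hi
    have hle : p ^ i ≤ n := Nat.pow_log_le_self p hn0
    have hlt : n < p ^ (i + 1) := Nat.lt_pow_succ_log_self hp.one_lt n
    obtain ⟨m, hm⟩ := Multiset.le_iff_exists_add.1 (Multiset.le_count_iff_replicate_le.1 hle)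
    have hmL : ∀ f ∈ m, f ∈ lyndonWords S := fun f hf =>
      lyndonFactors_subset (c :: u) f (by rw [hm]; exact Multiset.mem_add.2 (Or.inr hf))
    have hTL : wordPow l (p ^ i) ∈ tensorPowers p (lyndonWords S) := ⟨l, hlL, i, rfl⟩
    have hlead := (hasLead_word (lam := lam) (sortedConcat m)).mul_wordPow p hmL hlL (hg _ hTL)
    rw [add_comm m, ← hm, sortedConcat_lyndonFactors, one_mul] at hlead
    have hcount : m.count l / p ^ i + 1 = n / p ^ i := by
      rw [hn, hm, Multiset.count_add, Multiset.count_replicate_self,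
        Nat.add_div_left _ (pow_pos hp.pos i)]
    rw [hcount] at hlead
    have hne : ((n / p ^ i : ℕ) : ZMod p) ≠ 0 := by
      rw [Ne, ZMod.natCast_eq_zero_iff]
      refine Nat.not_dvd_of_pos_of_lt (Nat.div_pos hle (pow_pos hp.pos i)) ?_
      rw [Nat.div_lt_iff_lt_mul (pow_pos hp.pos i), ← pow_succ']
      exact hlt
    have hmem : word lam (sortedConcat m) ∈ A := by
      refine ih _ (wordKey_lt_iff.2 (Or.inl ?_))
      have hlen := length_maxShuffle (sortedConcat m) (wordPow l (p ^ i))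
      rw [maxShuffle, lyndonFactors_sortedConcat hmL, lyndonFactors_wordPow hlL, add_comm m, ← hm,
        sortedConcat_lyndonFactors] at hlen
      have := List.length_pos_of_ne_nil (wordPow_ne_nil hlL.1 (pow_pos hp.pos i).ne')
      omega
    have hprod := mul_mem hmem (Algebra.subset_adjoin (R := ZMod p) ⟨_, hTL, rfl⟩ : g _ ∈ A)
    have h1 := A.smul_mem (sub_mem hprod (hlow _ hlead)) ((n / p ^ i : ℕ) : ZMod p)⁻¹
    rwa [sub_sub_cancel, smul_smul, inv_mul_cancel₀ hne, one_smul] at h1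
  rw [← Algebra.toSubmodule_eq_top, eq_top_iff, ← span_word, Submodule.span_le]
  rintro _ ⟨w, rfl⟩
  exact hword w

theorem hasLead_wordMonomial {g : List S → MixableShuffle lam S}
    (hg : ∀ w ∈ tensorPowers p (lyndonWords S), HasLead (g w) w 1) (n : ℕ) {e : List S →₀ ℕ}
    (he : e ∈ reducedExponents p S) (hn : e.degree = n) :
    ∃ c : ZMod p, c ≠ 0 ∧ HasLead (wordMonomial g e) (sortedConcat (exponentFactors e)) c := by
  induction n generalizing e with
  | zero =>
    obtain rfl := (Finsupp.degree_eq_zero_iff e).1 hn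
    refine ⟨1, one_ne_zero, ?_⟩
    have h := hasLead_word (lam := lam) ([] : List S)
    simpa [wordMonomial, exponentFactors, sortedConcat, one_def] using h
  | succ n ih =>
    have hne : e ≠ 0 := by
      rintro rfl
      simp at hn
    obtain ⟨w, hw⟩ := Finsupp.ne_iff.1 hne
    obtain ⟨⟨l, hl, i, rfl⟩, hlt⟩ := he w hw
    set w := wordPow l (p ^ i) with hwdef
    obtain ⟨e', rfl⟩ : ∃ e', e = e' + Finsupp.single w 1 :=
      ⟨e - Finsupp.single w 1,
        (tsub_add_cancel_of_le (by simpa [Nat.one_le_iff_ne_zero] using hw)).symm⟩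
    have he' : e' ∈ reducedExponents p S := by
      intro v hv
      have h1 : (e' + Finsupp.single w 1 : List S →₀ ℕ) v ≠ 0 := by
        rw [Finsupp.add_apply]
        omega
      refine ⟨(he v h1).1, lt_of_le_of_lt ?_ (he v h1).2⟩
      rw [Finsupp.add_apply]
      omega
    rw [map_add, Finsupp.degree_single, Nat.add_right_cancel_iff] at hn
    obtain ⟨c, hc, hlead⟩ := ih he' hn
    have h := hlead.mul_wordPow p exponentFactors_mem hl (hg w ⟨l, hl, i, rfl⟩)
    have hfac : exponentFactors (e' + Finsupp.single w 1) =
        exponentFactors e' + Multiset.replicate (p ^ i) l := by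
      rw [exponentFactors, Finsupp.sum_add_index' (h := fun w m => m • lyndonFactors w)
        (fun _ => zero_smul _ _) (fun _ _ _ => add_smul _ _ _),
        Finsupp.sum_single_index (h := fun w m => m • lyndonFactors w) (zero_smul _ _), one_smul,
        lyndonFactors_wordPow hl, exponentFactors]
    rw [wordMonomial_add, wordMonomial_single, pow_one, hfac]
    refine ⟨_, mul_ne_zero hc ?_, h⟩
    -- the digit `e' w` is at most `p - 2`, as `e` is reduced and exceeds `e'` by one at `w`
    rw [Nat.cast_add, ← ZMod.natCast_mod, count_exponentFactors_digit p he' hl, ← Nat.cast_add, Ne,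
      ZMod.natCast_eq_zero_iff]
    rw [Finsupp.add_apply, Finsupp.single_eq_same] at hlt
    exact Nat.not_dvd_of_pos_of_lt (Nat.succ_pos _) hlt

/-- The monomials with exponents less than `p` in elements led by the tensor powers `l ^ ⊗ p ^ i`
of Lyndon words are linearly independent. -/
theorem linearIndependent_wordMonomial {g : List S → MixableShuffle lam S}
    (hg : ∀ w ∈ tensorPowers p (lyndonWords S), HasLead (g w) w 1) :
    LinearIndependent (ZMod p) fun e : reducedExponents p S => wordMonomial g e.1 := by
  refine linearIndependent_of_hasLead (φ := fun e => sortedConcat (exponentFactors e.1)) ?_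
    fun e => hasLead_wordMonomial p hg _ e.2 rfl
  intro e e' h
  refine Subtype.ext (exponentFactors_injOn p e.2 e'.2 ?_)
  have h' := congrArg lyndonFactors h
  rwa [lyndonFactors_sortedConcat exponentFactors_mem,
    lyndonFactors_sortedConcat exponentFactors_mem] at h'

end Monomials

/-! ### The letterwise Frobenius map on words -/

section WordFrob

variable {S : Type*}

theorem take_length_wordPow {u : List S} {n : ℕ} (hn : n ≠ 0) :
    (wordPow u n).take u.length = u := by
  obtain ⟨m, rfl⟩ := Nat.exists_eq_succ_of_ne_zero hn
  simp [wordPow, List.replicate_succ]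

theorem length_wordFrob [Mul S] (p : ℕ) (w : List S) : (wordFrob p w).length = w.length :=
  List.length_map _

theorem wordFrob_wordPow [Mul S] (p : ℕ) (u : List S) (n : ℕ) :
    wordFrob p (wordPow u n) = wordPow (wordFrob p u) n := by
  simp [wordFrob, wordPow, List.map_flatten]

theorem wordFrob_wordPow_eq_iff [Mul S] (p : ℕ) {u : List S} {n : ℕ} (hn : n ≠ 0) :
    wordFrob p (wordPow u n) = wordPow u n ↔ wordFrob p u = u := by
  rw [wordFrob_wordPow]
  refine ⟨fun h => ?_, fun h => by rw [h]⟩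
  rw [← take_length_wordPow (u := wordFrob p u) hn, h, length_wordFrob, take_length_wordPow hn]

theorem exists_eq_wordFrob_of_wordPow [Mul S] {p : ℕ} {u x : List S} {n : ℕ} (hn : n ≠ 0)
    (h : wordPow u n = wordFrob p x) : ∃ y, u = wordFrob p y := by
  refine ⟨x.take u.length, ?_⟩
  conv_lhs => rw [← take_length_wordPow (u := u) hn, h]
  exact List.map_take.symm

theorem tensorPowers_fixedPart [Mul S] {p : ℕ} (hp : 0 < p) (W : Set (List S)) :
    tensorPowers p (fixedPart p W) = fixedPart p (tensorPowers p W) := by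
  ext w
  constructor
  · rintro ⟨u, ⟨hu, hf⟩, i, rfl⟩
    exact ⟨⟨u, hu, i, rfl⟩, (wordFrob_wordPow_eq_iff p (pow_pos hp i).ne').2 hf⟩
  · rintro ⟨⟨u, hu, i, rfl⟩, hf⟩
    exact ⟨u, ⟨hu, (wordFrob_wordPow_eq_iff p (pow_pos hp i).ne').1 hf⟩, i, rfl⟩

theorem tensorPowers_movedPart [Mul S] {p : ℕ} (hp : 0 < p) (W : Set (List S)) :
    tensorPowers p (movedPart p W) = movedPart p (tensorPowers p W) := by
  ext w
  constructor
  · rintro ⟨u, ⟨hu, hf⟩, i, rfl⟩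
    exact ⟨⟨u, hu, i, rfl⟩, (wordFrob_wordPow_eq_iff p (pow_pos hp i).ne').not.2 hf⟩
  · rintro ⟨⟨u, hu, i, rfl⟩, hf⟩
    exact ⟨u, ⟨hu, (wordFrob_wordPow_eq_iff p (pow_pos hp i).ne').not.1 hf⟩, i, rfl⟩

theorem essentialPart_fixedPart [Mul S] (p : ℕ) (W : Set (List S)) :
    essentialPart p (fixedPart p W) = fixedPart p (essentialPart p W) := by
  ext w
  simp only [essentialPart, fixedPart, Set.mem_ofPred_eq]
  tauto

theorem essentialPart_movedPart [Mul S] (p : ℕ) (W : Set (List S)) :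
    essentialPart p (movedPart p W) = movedPart p (essentialPart p W) := by
  ext w
  simp only [essentialPart, movedPart, Set.mem_ofPred_eq]
  tauto

theorem TEL1_eq [Mul S] [LT S] {p : ℕ} (hp : 0 < p) : TEL1 p S = fixedPart p (TEL p S) := by
  rw [TEL1, essentialPart_fixedPart, tensorPowers_fixedPart hp, TEL]

theorem TEL2_eq [Mul S] [LT S] {p : ℕ} (hp : 0 < p) : TEL2 p S = movedPart p (TEL p S) := by
  rw [TEL2, essentialPart_movedPart, tensorPowers_movedPart hp, TEL]

theorem TL1_eq [Mul S] [LT S] {p : ℕ} (hp : 0 < p) :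
    TL1 p S = fixedPart p (tensorPowers p (lyndonWords S)) := by
  rw [TL1, tensorPowers_fixedPart hp]

theorem TL2_eq [Mul S] [LT S] {p : ℕ} (hp : 0 < p) :
    TL2 p S = movedPart p (tensorPowers p (lyndonWords S)) := by
  rw [TL2, tensorPowers_movedPart hp]

theorem TEL_subset [Mul S] [LT S] (p : ℕ) : TEL p S ⊆ tensorPowers p (lyndonWords S) := by
  rintro w ⟨u, hu, i, rfl⟩
  exact ⟨u, hu.1, i, rfl⟩

theorem ne_wordFrob_of_mem_TEL [Mul S] [LT S] {p : ℕ} (hp : 0 < p) {w : List S} (hw : w ∈ TEL p S)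
    (hm : wordFrob p w ≠ w) (x : List S) : w ≠ wordFrob p x := by
  obtain ⟨u, ⟨-, hu⟩, i, rfl⟩ := hw
  rw [Ne, wordFrob_wordPow_eq_iff p (pow_pos hp i).ne'] at hm
  intro h
  obtain ⟨y, hy⟩ := exists_eq_wordFrob_of_wordPow (pow_pos hp i).ne' h
  rcases hu with hu | hu
  · exact hm hu.symm
  · exact hu y hy

theorem word_pow_prime_pow {p : ℕ} [Fact p.Prime] [CommSemigroup S]
    {lam : ZMod p} (hlam : lam ≠ 0) (w : List S) (j : ℕ) :
    word lam w ^ p ^ j = word lam ((wordFrob p)^[j] w) := by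
  induction j with
  | zero => simp
  | succ j ih => rw [pow_succ, pow_mul, ih, word_pow_prime p hlam, Function.iterate_succ_apply']

theorem wordMonomial_sum {A ι : Type*} [CommMonoid A] (g : List S → A) (s : Finset ι)
    (f : ι → List S →₀ ℕ) : wordMonomial g (∑ i ∈ s, f i) = ∏ i ∈ s, wordMonomial g (f i) := by
  classical
  induction s using Finset.induction_on with
  | empty => simp [wordMonomial]
  | insert i s hi ih => rw [Finset.sum_insert hi, wordMonomial_add, ih, Finset.prod_insert hi]

end WordFrob

/-! ### Strictly monotone Frobenius maps -/

section Map

variable {S : Type*} [LinearOrder S]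

theorem map_lt_map_iff_of_strictMono {f : S → S} (hf : StrictMono f) {u v : List S} :
    u.map f < v.map f ↔ u < v := by
  induction u generalizing v with
  | nil => cases v <;> simp
  | cons a u ih =>
    cases v with
    | nil => simp
    | cons b v =>
      rw [List.map_cons, List.map_cons, List.cons_lt_cons_iff, List.cons_lt_cons_iff, ih,
        hf.lt_iff_lt, hf.injective.eq_iff]

theorem map_mem_lyndonWords_iff {f : S → S} (hf : StrictMono f) {w : List S} :
    w.map f ∈ lyndonWords S ↔ w ∈ lyndonWords S := by
  constructor
  · rintro ⟨h1, h2⟩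
    refine ⟨fun h => h1 (by simp [h]), fun u v huv hu hv => ?_⟩
    exact (map_lt_map_iff_of_strictMono hf).1
      (h2 (u.map f) (v.map f) (by rw [huv, List.map_append]) (by simpa using hu) (by simpa using hv))
  · rintro ⟨h1, h2⟩
    refine ⟨by simpa using h1, fun u v huv hu hv => ?_⟩
    obtain ⟨u', v', rfl, rfl, rfl⟩ := List.map_eq_append_iff.1 huv
    exact (map_lt_map_iff_of_strictMono hf).2
      (h2 u' v' rfl (by simpa using hu) (by simpa using hv))

theorem le_map {f : S → S} (hf : ∀ a, a ≤ f a) (w : List S) : w ≤ w.map f := by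
  induction w with
  | nil => simp
  | cons a w ih =>
    rw [List.map_cons]
    rcases (hf a).eq_or_lt with h | h
    · rw [← h]
      exact cons_le_cons_left a ih
    · exact (List.cons_lt_cons_iff.2 (Or.inl h)).le

theorem map_le {f : S → S} (hf : ∀ a, f a ≤ a) (w : List S) : w.map f ≤ w := by
  induction w with
  | nil => simp
  | cons a w ih =>
    rw [List.map_cons]
    rcases (hf a).eq_or_lt with h | h
    · rw [h]
      exact cons_le_cons_left a ih
    · exact (List.cons_lt_cons_iff.2 (Or.inl h)).le

end Map

section ClassP

variable {p : ℕ} {S : Type*} [CommSemigroup S] [LinearOrder S]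

theorem _root_.IsClassP.strictMono (h : IsClassP p S) : StrictMono fun s : S => semigroupPow s p :=
  fun a b hab => h.pow_lt_pow b a hab

theorem _root_.IsClassP.wordFrob_injective (h : IsClassP p S) :
    Function.Injective (wordFrob p : List S → List S) :=
  List.map_injective_iff.2 h.strictMono.injective

/-- Two words that are not letterwise `p`-th powers have disjoint orbits under `w ↦ w^(p)`. -/
theorem _root_.IsClassP.iterate_eq_iff (h : IsClassP p S) {u v : List S}
    (hu : ∀ x, u ≠ wordFrob p x) (hv : ∀ x, v ≠ wordFrob p x) {i j : ℕ} :
    (wordFrob p)^[i] u = (wordFrob p)^[j] v ↔ u = v ∧ i = j := by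
  refine ⟨fun e => ?_, by rintro ⟨rfl, rfl⟩; rfl⟩
  induction i generalizing j with
  | zero =>
    cases j with
    | zero => exact ⟨e, rfl⟩
    | succ j =>
      rw [Function.iterate_succ_apply'] at e
      exact absurd e (hu _)
  | succ i ih =>
    cases j with
    | zero =>
      rw [Function.iterate_succ_apply'] at e
      exact absurd e.symm (hv _)
    | succ j =>
      rw [Function.iterate_succ_apply', Function.iterate_succ_apply'] at e
      obtain ⟨h1, h2⟩ := ih (h.wordFrob_injective e)
      exact ⟨h1, by rw [h2]⟩

theorem _root_.IsClassP.eq_of_iterate_fixed (h : IsClassP p S) {u v : List S}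
    (hv : wordFrob p v = v) {i : ℕ} (e : (wordFrob p)^[i] u = v) : u = v :=
  h.wordFrob_injective.iterate i (e.trans (Function.iterate_fixed hv i).symm)

/-- Every Lyndon word arises by the Frobenius map from an essential one. -/
theorem _root_.IsClassP.exists_iterate_eq_lyndon (h : IsClassP p S) {l : List S}
    (hl : l ∈ lyndonWords S) :
    ∃ u ∈ essentialPart p (lyndonWords S), ∃ j : ℕ, l = (wordFrob p)^[j] u := by
  have := h.wellFounded
  revert hl
  refine wellFounded_wordKey.induction
    (C := fun l => l ∈ lyndonWords S → ∃ u ∈ essentialPart p (lyndonWords S), ∃ j : ℕ,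
      l = (wordFrob p)^[j] u) l fun l ih hl => ?_
  by_cases hfix : l = wordFrob p l
  · exact ⟨l, ⟨hl, Or.inl hfix⟩, 0, rfl⟩
  by_cases him : ∀ u, l ≠ wordFrob p u
  · exact ⟨l, ⟨hl, Or.inr him⟩, 0, rfl⟩
  push Not at him
  obtain ⟨u, rfl⟩ := him
  have hne : u ≠ wordFrob p u := fun e => hfix (congrArg (wordFrob p) e)
  have hlt : u < wordFrob p u := lt_of_le_of_ne (le_map h.le_pow u) hne
  obtain ⟨v, hv, j, hj⟩ := ih u (wordKey_lt_iff.2 (Or.inr ⟨(length_wordFrob p u).symm, hlt⟩))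
    ((map_mem_lyndonWords_iff h.strictMono).1 hl)
  exact ⟨v, hv, j + 1, by rw [Function.iterate_succ_apply', ← hj]⟩

theorem _root_.IsClassP.exists_iterate_eq (h : IsClassP p S) {w : List S}
    (hw : w ∈ tensorPowers p (lyndonWords S)) : ∃ u ∈ TEL p S, ∃ j : ℕ, w = (wordFrob p)^[j] u := by
  obtain ⟨l, hl, i, rfl⟩ := hw
  obtain ⟨u, hu, j, rfl⟩ := h.exists_iterate_eq_lyndon hl
  refine ⟨wordPow u (p ^ i), ⟨u, hu, i, rfl⟩, j, ?_⟩
  have hc : Function.Semiconj (fun x : List S => wordPow x (p ^ i)) (wordFrob p) (wordFrob p) :=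
    fun x => (wordFrob_wordPow p x _).symm
  exact hc.iterate_right j u

theorem _root_.IsClassP.iterate_mem (h : IsClassP p S) {w : List S}
    (hw : w ∈ tensorPowers p (lyndonWords S)) (j : ℕ) : (wordFrob p)^[j] w ∈ tensorPowers p (lyndonWords S) := by
  induction j with
  | zero => exact hw
  | succ j ih =>
    rw [Function.iterate_succ_apply']
    obtain ⟨l, hl, i, e⟩ := ih
    rw [e, wordFrob_wordPow]
    exact ⟨_, (map_mem_lyndonWords_iff h.strictMono).2 hl, i, rfl⟩

/-! ### Expansion of exponents in base `p` -/

open Classical in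
/-- The exponent vector that replaces each power `w ^ m` of a word with `w^(p) ≠ w` by the product
of the powers of `w^(p ^ j)` whose exponents are the digits of `m` in base `p`. -/
noncomputable def expandExponents (p : ℕ) (e : List S →₀ ℕ) : List S →₀ ℕ :=
  e.sum fun w m => if wordFrob p w = w then Finsupp.single w m else
    ∑ j ∈ Finset.range m, Finsupp.single ((wordFrob p)^[j] w) (m / p ^ j % p)

theorem expandExponents_apply_fixed (h : IsClassP p S) {e : List S →₀ ℕ} {w : List S}
    (hw : wordFrob p w = w) : expandExponents p e w = e w := by
  classical
  rw [expandExponents, Finsupp.sum_apply, Finsupp.sum, Finset.sum_eq_single w]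
  · rw [if_pos hw, Finsupp.single_eq_same]
  · intro v _ hvw
    split_ifs with hv
    · exact Finsupp.single_eq_of_ne hvw.symm
    · rw [Finsupp.finsetSum_apply]
      refine Finset.sum_eq_zero fun j _ => Finsupp.single_eq_of_ne fun e => ?_
      exact hvw (h.eq_of_iterate_fixed hw e.symm)
  · intro hn
    rw [if_pos hw, Finsupp.single_eq_same]
    simpa using hn

variable [Fact p.Prime] {lam : ZMod p}

theorem sum_digits_mul_pow (p m N : ℕ) :
    ∑ j ∈ Finset.range N, m / p ^ j % p * p ^ j = m % p ^ N := by
  induction N with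
  | zero => simp [Nat.mod_one]
  | succ N ih => rw [Finset.sum_range_succ, ih, Nat.mod_pow_succ, mul_comm]

theorem wordMonomial_expandExponents (hlam : lam ≠ 0) (e : List S →₀ ℕ) :
    wordMonomial (word lam) (expandExponents p e) = wordMonomial (word lam) e := by
  rw [expandExponents, Finsupp.sum, wordMonomial_sum, wordMonomial, Finsupp.prod]
  refine Finset.prod_congr rfl fun w _ => ?_
  split_ifs with hw
  · rw [wordMonomial_single]
  · rw [wordMonomial_sum]
    simp only [wordMonomial_single, ← word_pow_prime_pow hlam, ← pow_mul]
    rw [Finset.prod_pow_eq_pow_sum]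
    simp only [mul_comm (p ^ _)]
    rw [sum_digits_mul_pow,
      Nat.mod_eq_of_lt (Nat.lt_pow_self (Fact.out : p.Prime).one_lt)]

/-- The exponent vectors supported in `TEL`, with exponents less than `p` at the fixed words. -/
def essentialExponents (p : ℕ) (S : Type*) [CommSemigroup S] [LinearOrder S] : Set (List S →₀ ℕ) :=
  {e | ∀ w, e w ≠ 0 → w ∈ TEL p S ∧ (wordFrob p w = w → e w < p)}

theorem expandExponents_apply_iterate (h : IsClassP p S) {e : List S →₀ ℕ}
    (he : e ∈ essentialExponents p S) {w : List S} (hw : w ∈ TEL p S) (hm : wordFrob p w ≠ w)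
    (j : ℕ) : expandExponents p e ((wordFrob p)^[j] w) = e w / p ^ j % p := by
  classical
  have hp := (Fact.out : p.Prime)
  have hwim := ne_wordFrob_of_mem_TEL hp.pos hw hm
  rw [expandExponents, Finsupp.sum_apply, Finsupp.sum, Finset.sum_eq_single w]
  · rw [if_neg hm, Finsupp.finsetSum_apply, Finset.sum_eq_single j]
    · rw [Finsupp.single_eq_same]
    · intro i _ hij
      exact Finsupp.single_eq_of_ne fun e => hij ((h.iterate_eq_iff hwim hwim).1 e).2.symm
    · intro hj
      rw [Finset.mem_range, not_lt] at hj
      have : e w < p ^ j := hj.trans_lt (Nat.lt_pow_self hp.one_lt)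
      rw [Finsupp.single_eq_same, Nat.div_eq_of_lt this, Nat.zero_mod]
  · intro v hv hvw
    split_ifs with hf
    · exact Finsupp.single_eq_of_ne fun e => hvw (h.eq_of_iterate_fixed hf e).symm
    · have hvim := ne_wordFrob_of_mem_TEL hp.pos (he v (Finsupp.mem_support_iff.1 hv)).1 hf
      rw [Finsupp.finsetSum_apply]
      refine Finset.sum_eq_zero fun i _ => Finsupp.single_eq_of_ne fun e => ?_
      exact hvw ((h.iterate_eq_iff hwim hvim).1 e).1.symm
  · intro hn
    rw [Finsupp.notMem_support_iff.1 hn]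
    simp

theorem expandExponents_mem (h : IsClassP p S) {e : List S →₀ ℕ}
    (he : e ∈ essentialExponents p S) : expandExponents p e ∈ reducedExponents p S := by
  classical
  have hp := (Fact.out : p.Prime)
  intro w hw
  have hex : ∃ v ∈ TEL p S, ∃ j : ℕ, (wordFrob p)^[j] v = w := by
    by_contra hcon
    refine hw ?_
    rw [expandExponents, Finsupp.sum_apply]
    refine Finset.sum_eq_zero fun v hv => ?_
    have hvT := (he v (Finsupp.mem_support_iff.1 hv)).1
    beta_reduce
    split_ifs with hf
    · exact Finsupp.single_eq_of_ne fun e => hcon ⟨v, hvT, 0, e.symm⟩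
    · rw [Finsupp.finsetSum_apply]
      exact Finset.sum_eq_zero fun i _ => Finsupp.single_eq_of_ne fun e => hcon ⟨v, hvT, i, e.symm⟩
  obtain ⟨v, hv, j, rfl⟩ := hex
  refine ⟨h.iterate_mem (TEL_subset p hv) j, ?_⟩
  by_cases hf : wordFrob p v = v
  · rw [Function.iterate_fixed hf] at hw ⊢
    rw [expandExponents_apply_fixed h hf] at hw ⊢
    exact (he v hw).2 hf
  · rw [expandExponents_apply_iterate h he hv hf]
    exact Nat.mod_lt _ hp.pos

theorem expandExponents_injOn (h : IsClassP p S) :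
    Set.InjOn (expandExponents p) (essentialExponents p S) := by
  have hp := (Fact.out : p.Prime)
  intro e he e' he' heq
  ext w
  by_cases hw : w ∈ TEL p S
  · by_cases hf : wordFrob p w = w
    · rw [← expandExponents_apply_fixed h hf, heq, expandExponents_apply_fixed h hf]
    · have hdig : ∀ j, e w / p ^ j % p = e' w / p ^ j % p := fun j => by
        rw [← expandExponents_apply_iterate h he hw hf, heq,
          expandExponents_apply_iterate h he' hw hf]
      have h1 := sum_digits_mul_pow p (e w) (max (e w) (e' w))
      have h2 := sum_digits_mul_pow p (e' w) (max (e w) (e' w))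
      simp only [hdig] at h1
      have h3 := Nat.lt_pow_self hp.one_lt (n := max (e w) (e' w))
      rw [h1, Nat.mod_eq_of_lt (lt_of_le_of_lt (le_max_left _ _) h3),
        Nat.mod_eq_of_lt (lt_of_le_of_lt (le_max_right _ _) h3)] at h2
      exact h2
  · rw [not_not.1 (mt (fun h => (he w h).1) hw), not_not.1 (mt (fun h => (he' w h).1) hw)]

theorem linearIndependent_essential (h : IsClassP p S) (hlam : lam ≠ 0) :
    LinearIndependent (ZMod p)
      fun e : essentialExponents p S => wordMonomial (word lam) e.1 := by
  have h1 := linearIndependent_wordMonomial p (g := word lam) (S := S) fun w _ => hasLead_word w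
  let f : essentialExponents p S → reducedExponents p S := fun e =>
    ⟨expandExponents p e.1, expandExponents_mem h e.2⟩
  have hf : Function.Injective f := fun e e' hee =>
    Subtype.ext (expandExponents_injOn h e.2 e'.2 (congrArg Subtype.val hee))
  have h2 := h1.comp f hf
  convert h2 using 2 with e
  exact (wordMonomial_expandExponents hlam e.1).symm

end ClassP

/-! ### Injectivity from spanning families -/

section Abstract

variable {k : Type*} [CommRing k]

theorem injective_of_span_of_linearIndependent {V W ι : Type*} [AddCommGroup V] [Module k V]
    [AddCommGroup W] [Module k W] (F : V →ₗ[k] W) {v : ι → V}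
    (hv : Submodule.span k (Set.range v) = ⊤) (hi : LinearIndependent k (F ∘ v)) :
    Function.Injective F := by
  rw [injective_iff_map_eq_zero]
  intro x hx
  have hx' : x ∈ Submodule.span k (Set.range v) := hv ▸ Submodule.mem_top
  rw [← Finsupp.range_linearCombination] at hx'
  obtain ⟨c, rfl⟩ := hx'
  rw [Finsupp.apply_linearCombination] at hx
  rw [linearIndependent_iff.1 hi c hx, map_zero]

theorem span_range_tmul {P Q ι κ : Type*} [AddCommGroup P] [Module k P] [AddCommGroup Q]
    [Module k Q] {s : ι → P} {t : κ → Q} (hs : Submodule.span k (Set.range s) = ⊤)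
    (ht : Submodule.span k (Set.range t) = ⊤) :
    Submodule.span k (Set.range fun x : ι × κ => s x.1 ⊗ₜ[k] t x.2) = ⊤ := by
  have h := TensorProduct.map₂_mk_top_top_eq_top k P Q
  rw [← hs, ← ht, Submodule.map₂_span_span, Set.image2_range] at h
  exact h

theorem productMap_injective {P Q A ι κ : Type*} [CommRing P] [Algebra k P] [CommRing Q]
    [Algebra k Q] [CommRing A] [Algebra k A] (f : P →ₐ[k] A) (h : Q →ₐ[k] A) {s : ι → P} {t : κ → Q}
    (hs : Submodule.span k (Set.range s) = ⊤) (ht : Submodule.span k (Set.range t) = ⊤)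
    {u : ι × κ → A} (hi : LinearIndependent k u) (hu : ∀ x, f (s x.1) * h (t x.2) = u x) :
    Function.Injective (Algebra.TensorProduct.productMap f h) := by
  refine injective_of_span_of_linearIndependent
    (Algebra.TensorProduct.productMap f h).toLinearMap (span_range_tmul hs ht) ?_
  have heq : (Algebra.TensorProduct.productMap f h).toLinearMap ∘
      (fun x : ι × κ => s x.1 ⊗ₜ[k] t x.2) = u :=
    funext fun x => (Algebra.TensorProduct.productMap_apply_tmul f h _ _).trans (hu x)
  rw [heq]
  exact hi

theorem span_monomial (σ : Type*) :
    Submodule.span k (Set.range fun n : σ →₀ ℕ => MvPolynomial.monomial n (1 : k)) = ⊤ := by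
  have h := (MvPolynomial.basisMonomials σ k).span_eq
  rwa [MvPolynomial.coe_basisMonomials] at h

/-- The monomials whose exponents at the variables of `R` are less than `p`. -/
def ReducedMonomial {σ : Type*} (p : ℕ) (R : Set σ) : Type _ :=
  {n : σ →₀ ℕ // ∀ w ∈ R, n w < p}

/-- Modulo relations `X w ^ p = c w • X w` for `w ∈ R`, the monomials with exponents less than `p`
at the variables of `R` span the polynomial algebra. -/
theorem span_reducedMonomial {σ : Type*} {p : ℕ} (hp : 1 < p) (R : Set σ) (c : σ → k)
    (I : Ideal (MvPolynomial σ k))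
    (hI : ∀ w ∈ R, (MvPolynomial.X w ^ p - MvPolynomial.C (c w) * MvPolynomial.X w :
      MvPolynomial σ k) ∈ I) :
    Submodule.span k (Set.range fun n : ReducedMonomial p R =>
      Ideal.Quotient.mk I (MvPolynomial.monomial n.1 (1 : k))) = ⊤ := by
  classical
  set N := Submodule.span k (Set.range fun n : ReducedMonomial p R =>
      Ideal.Quotient.mk I (MvPolynomial.monomial n.1 (1 : k))) with hN
  have hsmul (a : k) (f : MvPolynomial σ k) :
      Ideal.Quotient.mk I (MvPolynomial.C a * f) = a • Ideal.Quotient.mk I f := by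
    rw [← MvPolynomial.smul_eq_C_mul]
    rfl
  have key : ∀ d : ℕ, ∀ n : σ →₀ ℕ, n.degree = d →
      Ideal.Quotient.mk I (MvPolynomial.monomial n (1 : k)) ∈ N := by
    intro d
    induction d using Nat.strong_induction_on with
    | _ d ih =>
    intro n hn
    by_cases hred : ∀ w ∈ R, n w < p
    · exact Submodule.subset_span ⟨⟨n, hred⟩, rfl⟩
    push Not at hred
    obtain ⟨w, hw, hle⟩ := hred
    obtain ⟨n', rfl⟩ : ∃ n', n = n' + Finsupp.single w p :=
      ⟨n - Finsupp.single w p, (tsub_add_cancel_of_le (by simpa using hle)).symm⟩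
    have h1 : Ideal.Quotient.mk I (MvPolynomial.monomial (n' + Finsupp.single w p) (1 : k)) =
        c w • Ideal.Quotient.mk I (MvPolynomial.monomial (n' + Finsupp.single w 1) (1 : k)) := by
      rw [← hsmul, Ideal.Quotient.eq, MvPolynomial.monomial_add_single,
        MvPolynomial.monomial_add_single, pow_one]
      have := I.mul_mem_left (MvPolynomial.monomial n' (1 : k)) (hI w hw)
      convert this using 1
      ring
    rw [h1]
    refine N.smul_mem _ (ih _ ?_ _ rfl)
    rw [← hn, map_add, map_add, Finsupp.degree_single, Finsupp.degree_single]
    omega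
  rw [eq_top_iff]
  intro x _
  obtain ⟨f, rfl⟩ := Ideal.Quotient.mk_surjective x
  have hf : f ∈ Submodule.span k (Set.range fun n : σ →₀ ℕ => MvPolynomial.monomial n (1 : k)) := by
    rw [span_monomial]
    exact Submodule.mem_top
  induction hf using Submodule.span_induction with
  | mem f hf =>
    obtain ⟨n, rfl⟩ := hf
    exact key _ n rfl
  | zero => rw [map_zero]; exact N.zero_mem
  | add f g _ _ hf hg => rw [map_add]; exact N.add_mem (hf trivial) (hg trivial)
  | smul a f _ hf =>
    rw [MvPolynomial.smul_eq_C_mul, hsmul]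
    exact N.smul_mem a (hf trivial)

theorem mapDomain_add_mapDomain_injective {α β γ : Type*} {f : α → γ} {h : β → γ}
    (hf : Function.Injective f) (hh : Function.Injective h) (hd : ∀ a b, f a ≠ h b) :
    Function.Injective fun x : (α →₀ ℕ) × (β →₀ ℕ) =>
      Finsupp.mapDomain f x.1 + Finsupp.mapDomain h x.2 := by
  rintro ⟨m, n⟩ ⟨m', n'⟩ e
  have h1 (x : α →₀ ℕ) (b : β) : Finsupp.mapDomain f x (h b) = 0 :=
    Finsupp.mapDomain_of_notMem_range _ _ (by rintro ⟨a, ha⟩; exact hd a b ha)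
  have h2 (x : β →₀ ℕ) (a : α) : Finsupp.mapDomain h x (f a) = 0 :=
    Finsupp.mapDomain_of_notMem_range _ _ (by rintro ⟨b, hb⟩; exact hd a b hb.symm)
  refine Prod.ext (Finsupp.ext fun a => ?_) (Finsupp.ext fun b => ?_)
  · simpa [h2, Finsupp.mapDomain_apply hf] using DFunLike.congr_fun e (f a)
  · simpa [h1, Finsupp.mapDomain_apply hh] using DFunLike.congr_fun e (h b)

end Abstract

/-! ### Presentations of the mixable shuffle algebra -/

section Presentation

variable {p : ℕ} [Fact p.Prime] {lam : ZMod p} {S : Type*}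

theorem wordMonomial_mapDomain {A : Type*} [CommRing A] [Algebra (ZMod p) A] {σ : Type*}
    (g : List S → A) (f : σ → List S) (n : σ →₀ ℕ) :
    wordMonomial g (Finsupp.mapDomain f n) =
      MvPolynomial.aeval (fun x => g (f x)) (MvPolynomial.monomial n (1 : ZMod p)) := by
  rw [wordMonomial, Finsupp.prod_mapDomain_index (fun _ => pow_zero _) fun _ _ _ => pow_add _ _ _,
    MvPolynomial.aeval_monomial, map_one, one_mul]

theorem span_frobIdeal (lam : ZMod p) (Y R : Set (List S)) :
    Submodule.span (ZMod p) (Set.range fun n : ReducedMonomial p {w : Y | (w : List S) ∈ R} =>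
      Ideal.Quotient.mk (frobIdeal p lam Y R) (MvPolynomial.monomial n.1 (1 : ZMod p))) = ⊤ :=
  span_reducedMonomial (Fact.out : p.Prime).one_lt _
    (fun w : Y => lam ^ ((p - 1) * ((w : List S).length - 1))) _
    fun w hw => by
      refine Ideal.subset_span ?_
      exact ⟨w, hw, rfl⟩

theorem span_powIdeal {A : Type*} (Y : Set A) :
    Submodule.span (ZMod p) (Set.range fun n : ReducedMonomial p (Set.univ : Set Y) =>
      Ideal.Quotient.mk (powIdeal (ZMod p) p Y) (MvPolynomial.monomial n.1 (1 : ZMod p))) = ⊤ :=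
  span_reducedMonomial (Fact.out : p.Prime).one_lt _ 0 _
    fun w _ => by
      refine Ideal.subset_span ?_
      exact ⟨w, by simp⟩

variable [CommSemigroup S]

/-- The map from the presented algebra `MvPolynomial Y / frobIdeal` that evaluates symbols at
words. -/
noncomputable def evalFrob (hlam : lam ≠ 0) (Y R : Set (List S))
    (hR : ∀ w ∈ R, wordFrob p w = w) :
    (MvPolynomial Y (ZMod p) ⧸ frobIdeal p lam Y R) →ₐ[ZMod p] MixableShuffle lam S :=
  Ideal.Quotient.liftₐ _ (MvPolynomial.aeval fun w : Y => word lam (w : List S)) (by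
    have h : frobIdeal p lam Y R ≤ RingHom.ker
        (MvPolynomial.aeval (R := ZMod p) fun w : Y => word lam (w : List S)) := by
      refine Ideal.span_le.2 ?_
      rintro _ ⟨w, hw, rfl⟩
      rw [lam_pow_eq_one p hlam]
      simp [RingHom.mem_ker, word_pow_prime p hlam, hR _ hw]
    exact fun a ha => h ha)

theorem evalFrob_mk (hlam : lam ≠ 0) (Y R : Set (List S)) (hR : ∀ w ∈ R, wordFrob p w = w)
    (f : MvPolynomial Y (ZMod p)) : evalFrob hlam Y R hR (Ideal.Quotient.mk _ f) =
      MvPolynomial.aeval (fun w : Y => word lam (w : List S)) f := rfl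

variable [LinearOrder S]

theorem surjective_of_forall_mem_range [WellFoundedLT S] {B : Type*} [Semiring B]
    [Algebra (ZMod p) B] (F : B →ₐ[ZMod p] MixableShuffle lam S) {g : List S → MixableShuffle lam S}
    (hg : ∀ w ∈ tensorPowers p (lyndonWords S), HasLead (g w) w 1)
    (hF : ∀ w ∈ tensorPowers p (lyndonWords S), g w ∈ F.range) : Function.Surjective F := by
  rw [← AlgHom.range_eq_top, eq_top_iff, ← adjoin_eq_top p hg]
  refine Algebra.adjoin_le ?_
  rintro _ ⟨w, hw, rfl⟩
  exact hF w hw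

/-- For `S` in `𝒫`, an algebra map that reaches the words of `TEL` is surjective. -/
theorem _root_.IsClassP.surjective_of_forall_mem_range (h : IsClassP p S) (hlam : lam ≠ 0)
    {B : Type*} [Semiring B] [Algebra (ZMod p) B] (F : B →ₐ[ZMod p] MixableShuffle lam S)
    (hF : ∀ w ∈ TEL p S, word lam w ∈ F.range) : Function.Surjective F := by
  have := h.wellFounded
  refine MixableShuffle.surjective_of_forall_mem_range F (g := word lam)
    (fun w _ => hasLead_word w) fun w hw => ?_
  obtain ⟨u, hu, j, rfl⟩ := h.exists_iterate_eq hw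
  rw [← word_pow_prime_pow hlam]
  exact pow_mem (hF u hu) _

theorem exists_algEquiv_TEL (h : IsClassP p S) (hlam : lam ≠ 0) :
    ∃ e : (MvPolynomial (TEL p S) (ZMod p) ⧸ frobIdeal p lam (TEL p S) (TEL1 p S))
        ≃ₐ[ZMod p] MixableShuffle lam S,
      ∀ w : TEL p S, e (Ideal.Quotient.mk _ (MvPolynomial.X w)) = word lam w := by
  have hp := (Fact.out : p.Prime).pos
  have hR : ∀ w ∈ TEL1 p S, wordFrob p w = w := fun w hw => (TEL1_eq (S := S) hp ▸ hw).2
  set F := evalFrob hlam (TEL p S) (TEL1 p S) hR with hFdef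
  have hX : ∀ w : TEL p S, F (Ideal.Quotient.mk _ (MvPolynomial.X w)) = word lam w := fun w => by
    rw [hFdef, evalFrob_mk, MvPolynomial.aeval_X]
  have hsurj : Function.Surjective F :=
    h.surjective_of_forall_mem_range hlam F fun w hw => ⟨_, hX ⟨w, hw⟩⟩
  have hinj : Function.Injective F := by
    refine injective_of_span_of_linearIndependent F.toLinearMap (span_frobIdeal lam _ _) ?_
    let f : ReducedMonomial p {w : TEL p S | (w : List S) ∈ TEL1 p S} → essentialExponents p S :=
      fun n => ⟨Finsupp.mapDomain Subtype.val n.1, fun w hw => by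
        have hwT : w ∈ TEL p S := by
          by_contra hn
          exact hw (Finsupp.mapDomain_of_notMem_range _ _ (by simpa using hn))
        refine ⟨hwT, fun hf => ?_⟩
        have := Finsupp.mapDomain_apply Subtype.val_injective n.1 (⟨w, hwT⟩ : TEL p S)
        rw [this]
        refine n.2 ⟨w, hwT⟩ ?_
        rw [Set.mem_ofPred_eq, TEL1_eq hp]
        exact ⟨hwT, hf⟩⟩
    have hf : Function.Injective f := fun n n' e =>
      Subtype.ext (Finsupp.mapDomain_injective Subtype.val_injective (congrArg Subtype.val e))
    have heq : F.toLinearMap ∘ (fun n : ReducedMonomial p {w : TEL p S | (w : List S) ∈ TEL1 p S} =>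
        Ideal.Quotient.mk (frobIdeal p lam (TEL p S) (TEL1 p S))
          (MvPolynomial.monomial n.1 (1 : ZMod p))) =
        (fun e : essentialExponents p S => wordMonomial (word lam) e.1) ∘ f :=
      funext fun n => (wordMonomial_mapDomain _ _ n.1).symm
    rw [heq]
    exact (linearIndependent_essential h hlam).comp f hf
  exact ⟨AlgEquiv.ofBijective F ⟨hinj, hsurj⟩, hX⟩

theorem exists_algEquiv_TEL1_TEL2 (h : IsClassP p S) (hlam : lam ≠ 0) :
    ∃ e : ((MvPolynomial (TEL1 p S) (ZMod p) ⧸ frobIdeal p lam (TEL1 p S) (TEL1 p S))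
        ⊗[ZMod p] MvPolynomial (TEL2 p S) (ZMod p)) ≃ₐ[ZMod p] MixableShuffle lam S,
      (∀ w : TEL1 p S, e (Ideal.Quotient.mk _ (MvPolynomial.X w) ⊗ₜ[ZMod p] 1) = word lam w) ∧
      (∀ w : TEL2 p S, e (1 ⊗ₜ[ZMod p] MvPolynomial.X w) = word lam w) := by
  have hp := (Fact.out : p.Prime).pos
  have h1 : ∀ w, w ∈ TEL1 p S ↔ w ∈ TEL p S ∧ wordFrob p w = w := fun w => by
    rw [TEL1_eq hp]; rfl
  have h2 : ∀ w, w ∈ TEL2 p S ↔ w ∈ TEL p S ∧ wordFrob p w ≠ w := fun w => by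
    rw [TEL2_eq hp]; rfl
  set P := evalFrob hlam (TEL1 p S) (TEL1 p S) fun w hw => ((h1 w).1 hw).2 with hPdef
  set Q : MvPolynomial (TEL2 p S) (ZMod p) →ₐ[ZMod p] MixableShuffle lam S :=
    MvPolynomial.aeval fun w : TEL2 p S => word lam (w : List S) with hQdef
  set F := Algebra.TensorProduct.productMap P Q with hFdef
  have hX1 : ∀ w : TEL1 p S,
      F (Ideal.Quotient.mk _ (MvPolynomial.X w) ⊗ₜ[ZMod p] 1) = word lam w := fun w => by
    rw [hFdef, Algebra.TensorProduct.productMap_apply_tmul, map_one, mul_one, hPdef, evalFrob_mk,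
      MvPolynomial.aeval_X]
  have hX2 : ∀ w : TEL2 p S, F (1 ⊗ₜ[ZMod p] MvPolynomial.X w) = word lam w := fun w => by
    rw [hFdef, Algebra.TensorProduct.productMap_apply_tmul, map_one, one_mul, hQdef,
      MvPolynomial.aeval_X]
  have hsurj : Function.Surjective F := by
    refine h.surjective_of_forall_mem_range hlam F fun w hw => ?_
    by_cases hf : wordFrob p w = w
    · exact ⟨_, hX1 ⟨w, (h1 w).2 ⟨hw, hf⟩⟩⟩
    · exact ⟨_, hX2 ⟨w, (h2 w).2 ⟨hw, hf⟩⟩⟩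
  have hinj : Function.Injective F := by
    have hd : ∀ (a : TEL1 p S) (b : TEL2 p S), (a : List S) ≠ b := fun a b e =>
      ((h2 _).1 b.2).2 (e ▸ ((h1 _).1 a.2).2)
    let f : ReducedMonomial p {w : TEL1 p S | (w : List S) ∈ TEL1 p S} × (TEL2 p S →₀ ℕ) →
        essentialExponents p S := fun x =>
      ⟨Finsupp.mapDomain Subtype.val x.1.1 + Finsupp.mapDomain Subtype.val x.2, fun w hw => by
        by_cases hw1 : w ∈ TEL1 p S
        · refine ⟨((h1 w).1 hw1).1, fun _ => ?_⟩
          have e1 := Finsupp.mapDomain_apply Subtype.val_injective x.1.1 (⟨w, hw1⟩ : TEL1 p S)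
          have e2 := Finsupp.mapDomain_of_notMem_range (f := (Subtype.val : TEL2 p S → List S)) x.2 w
            (by rintro ⟨b, rfl⟩; exact hd ⟨_, hw1⟩ b rfl)
          rw [Finsupp.add_apply, e1, e2, add_zero]
          exact x.1.2 _ hw1
        · have e1 := Finsupp.mapDomain_of_notMem_range (f := (Subtype.val : TEL1 p S → List S)) x.1.1
            w (by simpa using hw1)
          by_cases hw2 : w ∈ TEL2 p S
          · exact ⟨((h2 w).1 hw2).1, fun hf => absurd hf ((h2 w).1 hw2).2⟩
          · have e2 := Finsupp.mapDomain_of_notMem_range (f := (Subtype.val : TEL2 p S → List S)) x.2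
              w (by simpa using hw2)
            rw [Finsupp.add_apply, e1, e2] at hw
            exact absurd rfl hw⟩
    have hf : Function.Injective f := fun x y e => by
      have := mapDomain_add_mapDomain_injective Subtype.val_injective Subtype.val_injective hd
        (a₁ := (x.1.1, x.2)) (a₂ := (y.1.1, y.2)) (congrArg Subtype.val e)
      exact Prod.ext (Subtype.ext (Prod.mk.inj this).1) (Prod.mk.inj this).2
    refine productMap_injective P Q (span_frobIdeal lam _ _) (span_monomial _)
      ((linearIndependent_essential h hlam).comp f hf) fun x => ?_
    rw [Function.comp_apply, wordMonomial_add, wordMonomial_mapDomain (p := p),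
      wordMonomial_mapDomain (p := p)]
    rfl
  exact ⟨AlgEquiv.ofBijective F ⟨hinj, hsurj⟩, hX1, hX2⟩

end Presentation

/-! ### Free commutative semigroups -/

section Free

theorem coe_semigroupPow_freeCommSemigroup {X : Type*} (a : FreeCommSemigroup X) (n : ℕ) :
    (semigroupPow a (n + 1)).1 = a.1 ^ (n + 1) := by
  induction n with
  | zero => exact (pow_one _).symm
  | succ n ih =>
    rw [pow_succ, ← ih]
    rfl

variable {X : Type*} [LinearOrder X]

theorem lt_semigroupPow_freeCommSemigroup (a : FreeCommSemigroup X) {p : ℕ} (hp : 1 < p) :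
    a < semigroupPow a p := by
  obtain ⟨n, rfl⟩ := Nat.exists_eq_add_of_lt hp
  have h1 : (1 : Multiplicative (DegLex (X →₀ ℕ))) < a.1 :=
    lt_of_le_of_ne (bot_le (a := (Multiplicative.toAdd a.1 : DegLex (X →₀ ℕ)))) (Ne.symm a.2)
  change a.1 < (semigroupPow a (1 + n + 1)).1
  rw [coe_semigroupPow_freeCommSemigroup, pow_succ']
  exact lt_mul_of_one_lt_right' _ (one_lt_pow' h1 (by omega))

theorem isClassP_freeCommSemigroup [Finite X] {p : ℕ} (hp : 1 < p) :
    IsClassP p (FreeCommSemigroup X) where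
  wellFounded := by
    have h : WellFounded fun a b : DegLex (X →₀ ℕ) => a < b := wellFounded_lt
    exact ⟨InvImage.wf (fun a : FreeCommSemigroup X => (Multiplicative.toAdd a.1)) h⟩
  pow_lt_pow a b hab := by
    obtain ⟨n, rfl⟩ := Nat.exists_eq_add_of_lt hp
    change (semigroupPow b (1 + n + 1)).1 < (semigroupPow a (1 + n + 1)).1
    rw [coe_semigroupPow_freeCommSemigroup, coe_semigroupPow_freeCommSemigroup]
    exact pow_lt_pow_left' (by omega) hab
  le_pow a := (lt_semigroupPow_freeCommSemigroup a hp).le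

theorem TEL1_freeCommSemigroup {p : ℕ} (hp : 1 < p) : TEL1 p (FreeCommSemigroup X) = ∅ := by
  rw [Set.eq_empty_iff_forall_notMem]
  rintro _ ⟨l, ⟨⟨hl, hf⟩, -⟩, -⟩
  obtain ⟨a, l, rfl⟩ := List.exists_cons_of_ne_nil hl.1
  exact (lt_semigroupPow_freeCommSemigroup a hp).ne' (List.cons.inj hf).1

theorem exists_algEquiv_freeCommSemigroup {p : ℕ} [Fact p.Prime] {lam : ZMod p} (hlam : lam ≠ 0)
    [Finite X] :
    ∃ e : MvPolynomial (TEL p (FreeCommSemigroup X)) (ZMod p)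
        ≃ₐ[ZMod p] MixableShuffle lam (FreeCommSemigroup X),
      ∀ w : TEL p (FreeCommSemigroup X), e (MvPolynomial.X w) = word lam w := by
  have hp := (Fact.out : p.Prime).one_lt
  obtain ⟨e, he⟩ := exists_algEquiv_TEL (isClassP_freeCommSemigroup (X := X) hp) hlam
  have hbot : frobIdeal p lam (TEL p (FreeCommSemigroup X)) (TEL1 p (FreeCommSemigroup X)) = ⊥ := by
    rw [frobIdeal, Ideal.span_eq_bot]
    rintro _ ⟨w, hw, -⟩
    rw [TEL1_freeCommSemigroup hp] at hw
    exact absurd hw (Set.notMem_empty _)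
  refine ⟨((AlgEquiv.quotientBot (ZMod p) _).symm.trans
    (Ideal.quotientEquivAlgOfEq (ZMod p) hbot.symm)).trans e, fun w => ?_⟩
  rw [← he w]
  rfl

end Free

/-! ### Semigroups with idempotent Frobenius map -/

section ClassJ

open Classical in
/-- The generators of the presentation for `S` in `𝒥`: the words fixed by `w ↦ w^(p)`, and the
differences `w - w^(p)` for the other words. -/
noncomputable def frobDifference {p : ℕ} {S : Type*} [Mul S] (lam : ZMod p)
    (w : List S) : MixableShuffle lam S :=
  if wordFrob p w = w then word lam w else word lam w - word lam (wordFrob p w)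

theorem frobDifference_of_eq {p : ℕ} {S : Type*} [Mul S] {lam : ZMod p} {w : List S}
    (hw : wordFrob p w = w) :
    frobDifference lam w = word lam w := if_pos hw

theorem frobDifference_of_ne {p : ℕ} {S : Type*} [Mul S] {lam : ZMod p} {w : List S}
    (hw : wordFrob p w ≠ w) :
    frobDifference lam w = word lam w - word lam (wordFrob p w) := if_neg hw

variable {p : ℕ} [Fact p.Prime] {lam : ZMod p} {S : Type*} [CommSemigroup S]

theorem semigroupPow_semigroupPow {S : Type*} [Semigroup S] (g : S) {m n : ℕ} (hm : m ≠ 0)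
    (hn : n ≠ 0) : semigroupPow (semigroupPow g m) n = semigroupPow g (m * n) := by
  obtain ⟨a, rfl⟩ := Nat.exists_eq_succ_of_ne_zero hm
  obtain ⟨b, rfl⟩ := Nat.exists_eq_succ_of_ne_zero hn
  apply WithOne.coe_injective
  rw [coe_semigroupPow, coe_semigroupPow, ← pow_mul,
    show (a + 1) * (b + 1) = (a * b + a + b) + 1 by ring, coe_semigroupPow]

theorem nontrivial (lam : ZMod p) : Nontrivial (MixableShuffle lam S) :=
  ⟨1, 0, fun h => by
    have h' := congrArg (wordCoeff lam ([] : List S)) h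
    rw [one_def, wordCoeff_word_self, map_zero] at h'
    exact one_ne_zero h'⟩

theorem charP (lam : ZMod p) : CharP (MixableShuffle lam S) p :=
  have := nontrivial (S := S) lam
  (Algebra.charP_iff (ZMod p) (MixableShuffle lam S) p).1 inferInstance

variable [LinearOrder S]

theorem _root_.IsClassJ.wordFrob_wordFrob (h : IsClassJ p S) (w : List S) :
    wordFrob p (wordFrob p w) = wordFrob p w := by
  have hp := (Fact.out : p.Prime).ne_zero
  rw [wordFrob, wordFrob, List.map_map]
  refine List.map_congr_left fun s _ => ?_
  rw [Function.comp_apply, semigroupPow_semigroupPow s hp hp, ← pow_two, h.pow_sq]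

theorem _root_.IsClassJ.wordFrob_lt (h : IsClassJ p S) {w : List S} (hw : wordFrob p w ≠ w) :
    wordFrob p w < w := by
  have hp := (Fact.out : p.Prime).ne_zero
  refine lt_of_le_of_ne (map_le (fun a => ?_) w) hw
  by_cases ha : semigroupPow a p = a
  · exact ha.le
  · refine (h.fixed_lt _ _ ?_ ha).le
    rw [semigroupPow_semigroupPow a hp hp, ← pow_two, h.pow_sq]

theorem hasLead_frobDifference (h : IsClassJ p S) (w : List S) :
    HasLead (frobDifference lam w) w 1 := by
  by_cases hw : wordFrob p w = w
  · rw [frobDifference_of_eq hw]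
    exact hasLead_word w
  · rw [frobDifference_of_ne hw, sub_eq_add_neg, ← add_zero (1 : ZMod p)]
    refine (hasLead_word w).add (hasLead_zero.2 (neg_mem (word_mem_lowerWords ?_)))
    exact wordKey_lt_iff.2 (Or.inr ⟨length_wordFrob p w, h.wordFrob_lt hw⟩)

/-- The map from the algebra presented by `powIdeal` that evaluates symbols at the differences
`w - w^(p)`. -/
noncomputable def evalDifferences (h : IsClassJ p S) (hlam : lam ≠ 0) :
    (MvPolynomial (differencesTL2 p S lam) (ZMod p) ⧸ powIdeal (ZMod p) p (differencesTL2 p S lam))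
      →ₐ[ZMod p] MixableShuffle lam S :=
  Ideal.Quotient.liftₐ _ (MvPolynomial.aeval Subtype.val) (by
    have hle : powIdeal (ZMod p) p (differencesTL2 p S lam) ≤ RingHom.ker
        (MvPolynomial.aeval (R := ZMod p)
          (Subtype.val : differencesTL2 p S lam → MixableShuffle lam S)) := by
      refine Ideal.span_le.2 ?_
      rintro _ ⟨⟨_, w, hw, rfl⟩, rfl⟩
      have := charP (S := S) lam
      simp [RingHom.mem_ker, sub_pow_char, word_pow_prime p hlam, h.wordFrob_wordFrob]
    exact fun a ha => hle ha)

theorem evalDifferences_mk (h : IsClassJ p S) (hlam : lam ≠ 0)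
    (f : MvPolynomial (differencesTL2 p S lam) (ZMod p)) :
    evalDifferences h hlam (Ideal.Quotient.mk _ f) = MvPolynomial.aeval Subtype.val f := rfl

theorem exists_algEquiv_TL1_differences (h : IsClassJ p S) (hlam : lam ≠ 0) :
    ∃ e : ((MvPolynomial (TL1 p S) (ZMod p) ⧸ frobIdeal p lam (TL1 p S) (TL1 p S)) ⊗[ZMod p]
          (MvPolynomial (differencesTL2 p S lam) (ZMod p) ⧸
            powIdeal (ZMod p) p (differencesTL2 p S lam))) ≃ₐ[ZMod p] MixableShuffle lam S,
      (∀ w : TL1 p S, e (Ideal.Quotient.mk _ (MvPolynomial.X w) ⊗ₜ[ZMod p] 1) = word lam w) ∧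
      (∀ y : differencesTL2 p S lam,
        e (1 ⊗ₜ[ZMod p] Ideal.Quotient.mk _ (MvPolynomial.X y)) = y) := by
  have := h.wellFounded
  have hp := (Fact.out : p.Prime).pos
  have h1 : ∀ w, w ∈ TL1 p S ↔ w ∈ tensorPowers p (lyndonWords S) ∧ wordFrob p w = w := fun w => by
    rw [TL1_eq hp]; rfl
  have h2 : ∀ w, w ∈ TL2 p S ↔ w ∈ tensorPowers p (lyndonWords S) ∧ wordFrob p w ≠ w := fun w => by
    rw [TL2_eq hp]; rfl
  -- `κ` recovers the word `w` from the symbol of `w - w^(p)`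
  choose κ hκ hκe using fun y : differencesTL2 p S lam => y.2
  have hκg (y : differencesTL2 p S lam) : frobDifference lam (κ y) = y := by
    rw [frobDifference_of_ne ((h2 _).1 (hκ y)).2, ← hκe]
  have hκi : Function.Injective κ := fun y y' e => Subtype.ext (by rw [← hκg, e, hκg])
  set P := evalFrob hlam (TL1 p S) (TL1 p S) fun w hw => ((h1 w).1 hw).2 with hPdef
  set Q := evalDifferences h hlam with hQdef
  set F := Algebra.TensorProduct.productMap P Q with hFdef
  have hX1 : ∀ w : TL1 p S,
      F (Ideal.Quotient.mk _ (MvPolynomial.X w) ⊗ₜ[ZMod p] 1) = word lam w := fun w => by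
    rw [hFdef, Algebra.TensorProduct.productMap_apply_tmul, map_one, mul_one, hPdef, evalFrob_mk,
      MvPolynomial.aeval_X]
  have hX2 : ∀ y : differencesTL2 p S lam,
      F (1 ⊗ₜ[ZMod p] Ideal.Quotient.mk _ (MvPolynomial.X y)) = y := fun y => by
    rw [hFdef, Algebra.TensorProduct.productMap_apply_tmul, map_one, one_mul, hQdef,
      evalDifferences_mk, MvPolynomial.aeval_X]
  have hsurj : Function.Surjective F := by
    refine surjective_of_forall_mem_range F (g := frobDifference lam)
      (fun w _ => hasLead_frobDifference h w) fun w hw => ?_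
    by_cases hf : wordFrob p w = w
    · rw [frobDifference_of_eq hf]
      exact ⟨_, hX1 ⟨w, (h1 w).2 ⟨hw, hf⟩⟩⟩
    · rw [frobDifference_of_ne hf]
      exact ⟨_, hX2 ⟨_, w, (h2 w).2 ⟨hw, hf⟩, rfl⟩⟩
  have hinj : Function.Injective F := by
    have hd : ∀ (a : TL1 p S) (y : differencesTL2 p S lam), (a : List S) ≠ κ y := fun a y e =>
      ((h2 _).1 (hκ y)).2 (e ▸ ((h1 _).1 a.2).2)
    let f : ReducedMonomial p {w : TL1 p S | (w : List S) ∈ TL1 p S} ×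
        ReducedMonomial p (Set.univ : Set (differencesTL2 p S lam)) → reducedExponents p S := fun x =>
      ⟨Finsupp.mapDomain Subtype.val x.1.1 + Finsupp.mapDomain κ x.2.1, fun w hw => by
        by_cases hw1 : w ∈ TL1 p S
        · refine ⟨((h1 w).1 hw1).1, ?_⟩
          have e1 := Finsupp.mapDomain_apply Subtype.val_injective x.1.1 (⟨w, hw1⟩ : TL1 p S)
          have e2 := Finsupp.mapDomain_of_notMem_range (f := κ) x.2.1 w
            (by rintro ⟨b, rfl⟩; exact hd ⟨_, hw1⟩ b rfl)
          rw [Finsupp.add_apply, e1, e2, add_zero]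
          exact x.1.2 _ hw1
        · have e1 := Finsupp.mapDomain_of_notMem_range (f := (Subtype.val : TL1 p S → List S)) x.1.1
            w (by simpa using hw1)
          rw [Finsupp.add_apply, e1, zero_add] at hw ⊢
          by_cases hw2 : w ∈ Set.range κ
          · obtain ⟨y, rfl⟩ := hw2
            rw [Finsupp.mapDomain_apply hκi]
            exact ⟨((h2 _).1 (hκ y)).1, x.2.2 y trivial⟩
          · exact absurd (Finsupp.mapDomain_of_notMem_range _ _ hw2) hw⟩
    have hf : Function.Injective f := fun x y e => by
      have := mapDomain_add_mapDomain_injective Subtype.val_injective hκi hd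
        (a₁ := (x.1.1, x.2.1)) (a₂ := (y.1.1, y.2.1)) (congrArg Subtype.val e)
      exact Prod.ext (Subtype.ext (Prod.mk.inj this).1) (Subtype.ext (Prod.mk.inj this).2)
    have hli := linearIndependent_wordMonomial p (g := frobDifference lam) (S := S)
      fun w _ => hasLead_frobDifference h w
    refine productMap_injective P Q (span_frobIdeal lam _ _) (span_powIdeal _)
      (hli.comp f hf) fun x => ?_
    rw [Function.comp_apply, wordMonomial_add, wordMonomial_mapDomain (p := p),
      wordMonomial_mapDomain (p := p)]
    simp only [hκg, frobDifference_of_eq ((h1 _).1 (Subtype.property _)).2]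
    rfl
  exact ⟨AlgEquiv.ofBijective F ⟨hinj, hsurj⟩, hX1, hX2⟩

end ClassJ

end MixableShuffle

theorem mainTheorem1 (p : ℕ) [Fact p.Prime] (lam : ZMod p) (hlam : lam ≠ 0) :
    (∀ (S : Type*) [CommSemigroup S] [LinearOrder S], IsClassP p S →
      (∃ e : (MvPolynomial (TEL p S) (ZMod p) ⧸ frobIdeal p lam (TEL p S) (TEL1 p S))
            ≃ₐ[ZMod p] MixableShuffle lam S,
          ∀ w : TEL p S, e (Ideal.Quotient.mk _ (MvPolynomial.X w)) = MixableShuffle.word lam w) ∧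
      (∃ e : ((MvPolynomial (TEL1 p S) (ZMod p) ⧸ frobIdeal p lam (TEL1 p S) (TEL1 p S))
              ⊗[ZMod p] MvPolynomial (TEL2 p S) (ZMod p)) ≃ₐ[ZMod p] MixableShuffle lam S,
          (∀ w : TEL1 p S, e (Ideal.Quotient.mk _ (MvPolynomial.X w) ⊗ₜ[ZMod p] 1) =
            MixableShuffle.word lam w) ∧
          (∀ w : TEL2 p S, e (1 ⊗ₜ[ZMod p] MvPolynomial.X w) = MixableShuffle.word lam w))) ∧
    (∀ (X : Type*) [Finite X] [LinearOrder X],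
      ∃ e : MvPolynomial (TEL p (FreeCommSemigroup X)) (ZMod p)
          ≃ₐ[ZMod p] MixableShuffle lam (FreeCommSemigroup X),
        ∀ w : TEL p (FreeCommSemigroup X), e (MvPolynomial.X w) = MixableShuffle.word lam w) ∧
    (∀ (S : Type*) [CommSemigroup S] [LinearOrder S], IsClassJ p S →
      ∃ e : ((MvPolynomial (TL1 p S) (ZMod p) ⧸ frobIdeal p lam (TL1 p S) (TL1 p S)) ⊗[ZMod p]
            (MvPolynomial (differencesTL2 p S lam) (ZMod p) ⧸
              powIdeal (ZMod p) p (differencesTL2 p S lam))) ≃ₐ[ZMod p] MixableShuffle lam S,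
        (∀ w : TL1 p S, e (Ideal.Quotient.mk _ (MvPolynomial.X w) ⊗ₜ[ZMod p] 1) =
          MixableShuffle.word lam w) ∧
        (∀ y : differencesTL2 p S lam,
          e (1 ⊗ₜ[ZMod p] Ideal.Quotient.mk _ (MvPolynomial.X y)) = y)) := by
  exact ⟨fun S _ _ h => ⟨MixableShuffle.exists_algEquiv_TEL h hlam,
      MixableShuffle.exists_algEquiv_TEL1_TEL2 h hlam⟩,
    fun X _ _ => MixableShuffle.exists_algEquiv_freeCommSemigroup hlam,
    fun S _ _ h => MixableShuffle.exists_algEquiv_TL1_differences h hlam⟩
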